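/- **Notation.** For $\alpha\in[-1,1]$, real $k\ge 0$ and $f:[-1,1]\to\mathbb{C}$ continuous, let $$I_k^\alpha(f)=\int_{-1}^1 f(x)\,\log\big((x-\alpha)^2\big)\,e^{ikx}\,dx .$$ For an integer $N\ge 1$ let $Q_Nf$ be the polynomial of degree at most $N$ with $(Q_Nf)(\cos(n\pi/N))=f(\cos(n\pi/N))$ for $n=0,\dots,N$, and let $I_{k,N}^\alpha(f)=I_k^\alpha(Q_Nf)$ be the product Filon–Clenshaw–Curtis rule. Put $f_c(\theta)=f(\cos\theta)$. For $r\ge 0$ let $H^r_\#$ be the Sobolev space of $2\pi$-periodic, locally square integrable functions $\varphi$ for which $$\|\varphi\|_{H^r_\#}^2=|\widehat\varphi(0)|^2+\sum_{n\in\mathbb{Z},\,n\neq 0}|n|^{2r}|\widehat\varphi(n)|^2<\infty,\qquad \widehat\varphi(n)=\frac1{2\pi}\int_{-\pi}^{\pi}\varphi(\theta)e^{-in\theta}\,d\theta .$$ **Theorem.** (i) For every $\alpha\in[-1,1]$ there is a constant $C_\alpha>0$ such that, for $\delta\in\{0,1\}$, all real $r\ge1$, all real $k\ge0$, all integers $N\ge1$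 and all continuous $f:[-1,1]\to\mathbb{C}$ with $f_c\in H^r_\#$, $$|I_k^\alpha(f)-I_{k,N}^\alpha(f)|\le C_\alpha\,(1+k)^{-\delta}\,N^{\delta-r}\,\|f_c\|_{H^r_\#}.$$ (ii) For every $\varepsilon>0$ there is a constant $C_\varepsilon>0$ such that, whenever either $\alpha\in\{-1,1\}$, $N\ge1$ and $k\ge1$, or $\alpha=0$, $N\ge 2$ is even and $k\ge0$, $$|I_k^\alpha(f)-I_{k,N}^\alpha(f)|\le C_\varepsilon\,(1+k)^{-2}\,(1+\alpha^2\log k)\,N^{7/2+\varepsilon-r}\,\|f_c\|_{H^r_\#}$$ for all real $r>7/2+\varepsilon$ and all continuous $f:[-1,1]\to\mathbb{C}$ with $f_c\in H^r_\#$. (For $\alpha=0$ the factor $1+\alpha^2\log k$ is read as $1$, also at $k=0$.) -/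

import Mathlib

open scoped Real

noncomputable section

namespace FilonCC

/-- The `n`-th Fourier coefficient `(1 / 2π) ∫_{-π}^{π} φ(θ) exp(-inθ) dθ`. -/
def fourierHat (φ : ℝ → ℂ) (n : ℤ) : ℂ :=
  fourierCoeffOn (neg_lt_self Real.pi_pos) φ n

theorem fourierHat_eq (φ : ℝ → ℂ) (n : ℤ) :
    fourierHat φ n = (1 / (2 * (π : ℂ))) *
      ∫ θ in (-π)..π, φ θ * Complex.exp (-(Complex.I * n * θ)) := by
  have hπ : (π : ℂ) ≠ 0 := by exact_mod_cast Real.pi_ne_zero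
  rw [fourierHat, fourierCoeffOn_eq_integral, Complex.real_smul]
  congr 1
  · push_cast
    ring
  · refine intervalIntegral.integral_congr fun θ _ => ?_
    simp only [fourier_coe_apply, smul_eq_mul]
    rw [mul_comm]
    congr 2
    push_cast
    field_simp
    ring

/-- The `n`-th term of the squared norm of the periodic Sobolev space `H^r_#`. -/
def sobolevTerm (r : ℝ) (φ : ℝ → ℂ) (n : ℤ) : ℝ :=
  (if n = 0 then 1 else |(n : ℝ)| ^ (2 * r)) * ‖fourierHat φ n‖ ^ 2

/-- Membership in the `2π`-periodic Sobolev space `H^r_#` (`r ≥ 0`): a `2π`-periodic, locally square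
integrable function with `∑_{n ≠ 0} |n|^{2r} |φ̂(n)|² < ∞`. -/
def MemPeriodicSobolev (r : ℝ) (φ : ℝ → ℂ) : Prop :=
  Function.Periodic φ (2 * π) ∧
  MeasureTheory.MemLp φ 2 (MeasureTheory.volume.restrict (Set.Ioc (-π) π)) ∧
  Summable (sobolevTerm r φ)

/-- The norm `(|φ̂(0)|² + ∑_{n ≠ 0} |n|^{2r} |φ̂(n)|²)^{1/2}` of `H^r_#`. -/
def periodicSobolevNorm (r : ℝ) (φ : ℝ → ℂ) : ℝ :=
  Real.sqrt (∑' n : ℤ, sobolevTerm r φ n)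

/-- The even periodic function `f_c(θ) = f(cos θ)`. -/
def cosTransform (f : ℝ → ℂ) : ℝ → ℂ := fun θ => f (Real.cos θ)

/-- The Chebyshev node `cos(nπ/N)`. -/
def chebNode (N n : ℕ) : ℝ := Real.cos (n * π / N)

theorem chebNode_injOn {N : ℕ} (hN : 1 ≤ N) :
    Set.InjOn (fun n => (chebNode N n : ℂ)) (Finset.range (N + 1) : Set ℕ) := by
  have hN' : (0 : ℝ) < N := by exact_mod_cast hN
  have mem : ∀ n ∈ (Finset.range (N + 1) : Set ℕ), (n * π / N : ℝ) ∈ Set.Icc 0 π := by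
    intro n hn
    have h : n ≤ N := by simpa [Nat.lt_succ_iff] using hn
    have h' : (n : ℝ) ≤ N := by exact_mod_cast h
    refine ⟨by positivity, ?_⟩
    rw [div_le_iff₀ hN', mul_comm π]
    exact mul_le_mul_of_nonneg_right h' Real.pi_pos.le
  intro a ha b hb hab
  have h1 : chebNode N a = chebNode N b := by simpa using hab
  have h2 := Real.injOn_cos (mem a ha) (mem b hb) h1
  have h3 : (a : ℝ) = b := by
    field_simp at h2
    exact h2
  exact_mod_cast h3

/-- `Q_N f`, the polynomial of degree at most `N` with
`(Q_N f)(cos(nπ/N)) = f(cos(nπ/N))` for `n = 0, …, N` (with `N ≥ 1`). -/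
def interpolant (N : ℕ) (f : ℝ → ℂ) : Polynomial ℂ :=
  Lagrange.interpolate (Finset.range (N + 1)) (fun n => (chebNode N n : ℂ))
    (fun n => f (chebNode N n))

theorem interpolant_eq_iff {N : ℕ} (hN : 1 ≤ N) (f : ℝ → ℂ) (p : Polynomial ℂ) :
    p = interpolant N f ↔
      p.natDegree ≤ N ∧ ∀ n ≤ N, p.eval (chebNode N n : ℂ) = f (chebNode N n) := by
  have inj := chebNode_injOn hN
  constructor
  · rintro rfl
    refine ⟨?_, fun n hn => Lagrange.eval_interpolate_at_node _ inj (by simp; omega)⟩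
    have h := Lagrange.degree_interpolate_lt (fun n => f (chebNode N n)) inj
    rw [Finset.card_range] at h
    refine Polynomial.natDegree_le_iff_coeff_eq_zero.2 fun m hm => ?_
    exact Polynomial.coeff_eq_zero_of_degree_lt
      (lt_of_lt_of_le h (by exact_mod_cast Nat.succ_le_of_lt hm))
  · rintro ⟨hd, hp⟩
    refine Lagrange.eq_interpolate_of_eval_eq _ inj ?_ fun n hn => hp n (by simp at hn; omega)
    rw [Finset.card_range]
    refine lt_of_le_of_lt (Polynomial.natDegree_le_iff_degree_le.1 hd) ?_
    exact_mod_cast Nat.lt_succ_self N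

/-- `I_k^α(f) = ∫_{-1}^{1} f(x) log((x-α)²) exp(ikx) dx`. -/
def oscIntegral (α k : ℝ) (f : ℝ → ℂ) : ℂ :=
  ∫ x in (-1 : ℝ)..1,
    f x * (Real.log ((x - α) ^ 2) : ℂ) * Complex.exp (Complex.I * k * x)

/-- The product Filon–Clenshaw–Curtis rule `I_{k,N}^α(f) = I_k^α(Q_N f)`. -/
def filonRule (α k : ℝ) (N : ℕ) (f : ℝ → ℂ) : ℂ :=
  oscIntegral α k (fun x => (interpolant N f).eval (x : ℂ))

end FilonCC

end

open scoped Real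
open MeasureTheory

namespace FilonCC

open Polynomial

/-! Since `f(cos θ)` has absolutely summable Fourier coefficients, `f = ∑ c_n T_n`. At the nodes
`T_n` agrees with `T_{n'}`, where `n' ≤ N` and `n ≡ ±n'` modulo `2N`. Hence `f - Q_N f = ∑_{n > N}
c_n (T_n - T_{n'})`, and everything reduces to bounding the oscillatory integral of finite pieces of
this series (`aliasError`) uniformly in the truncation; dominated convergence does the rest
(`norm_oscIntegral_sub_filonRule_le`).

Part (i) measures the error in the variable `θ`. The logarithm is square integrable in `θ`, so the
integral is bounded by the `L²` norm of the error (`norm_oscIntegral_le_valNorm`). One integration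
by parts, after subtracting the value at `α`, gains `1/k` at the price of the `L²` norm of the
`θ`-derivative (`norm_oscIntegral_sub_le`). The subtracted value is multiplied by the integral of
the bare weight: that is `O(1/k)` for interior `α`, and for `α = ±1` the value itself vanishes
because the endpoints are nodes. Orthogonality of cosines and sines, with a Cauchy–Schwarz estimate
on each aliasing class (`sum_union_aliasCoeff_le`), bounds the two norms by `N^{-r}` and `N^{1-r}`.

Part (ii) works term by term. For `α ∈ {-1, 0, 1}`, with `N` even if `α = 0`, the point `α` is a
node, so `T_n - T_{n'}` vanishes at `α` and at `±1`. Integration by parts then has no boundary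
terms, and both remaining integrals, one with `T_n'` and one with a divided difference, are again
`O(1/k)` up to the logarithm, with cubic growth in `n` (`exists_norm_oscIntegral_T_sub_T_le`).
Summing `n³ |c_n|` by Cauchy–Schwarz costs the exponent `3 + 1/2 + ε`. -/

/-! ### The substitution `x = cos θ` and square integrability of the logarithmic weight. -/

theorem integral_comp_cos {E : Type*} [NormedAddCommGroup E] [NormedSpace ℝ E] (g : ℝ → E) :
    ∫ x in (-1 : ℝ)..1, g x = ∫ θ in (0 : ℝ)..π, Real.sin θ • g (Real.cos θ) := by
  rw [intervalIntegral.integral_of_le (by norm_num), intervalIntegral.integral_of_le Real.pi_pos.le,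
    ← integral_Icc_eq_integral_Ioc, ← integral_Icc_eq_integral_Ioc,
    ← Real.bijOn_cos.image_eq,
    integral_image_eq_integral_abs_deriv_smul measurableSet_Icc
      (fun x _ => (Real.hasDerivAt_cos x).hasDerivWithinAt) Real.injOn_cos]
  refine setIntegral_congr_fun measurableSet_Icc fun θ hθ => ?_
  simp only [abs_neg, abs_of_nonneg (Real.sin_nonneg_of_nonneg_of_le_pi hθ.1 hθ.2)]

theorem integral_mul_le_sqrt_mul_sqrt {a b : ℝ} (hab : a ≤ b) {f g : ℝ → ℝ}
    (hf0 : ∀ x, 0 ≤ f x) (hg0 : ∀ x, 0 ≤ g x)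
    (hfm : Measurable f) (hgm : Measurable g)
    (hf : IntervalIntegrable (fun x => f x ^ 2) volume a b)
    (hg : IntervalIntegrable (fun x => g x ^ 2) volume a b) :
    IntervalIntegrable (fun x => f x * g x) volume a b ∧
    ∫ x in a..b, f x * g x ≤ √(∫ x in a..b, f x ^ 2) * √(∫ x in a..b, g x ^ 2) := by
  rw [intervalIntegrable_iff_integrableOn_Ioc_of_le hab] at hf hg
  have mf : MemLp f 2 (volume.restrict (Set.Ioc a b)) :=
    (memLp_two_iff_integrable_sq hfm.aestronglyMeasurable).2 hf
  have mg : MemLp g 2 (volume.restrict (Set.Ioc a b)) :=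
    (memLp_two_iff_integrable_sq hgm.aestronglyMeasurable).2 hg
  refine ⟨(intervalIntegrable_iff_integrableOn_Ioc_of_le hab).2 (mf.integrable_mul mg), ?_⟩
  have key := integral_mul_le_Lp_mul_Lq_of_nonneg (μ := volume.restrict (Set.Ioc a b))
    Real.HolderConjugate.two_two (f := f) (g := g) (Filter.Eventually.of_forall hf0)
    (Filter.Eventually.of_forall hg0) (by simpa using mf) (by simpa using mg)
  simp only [intervalIntegral.integral_of_le hab, Real.sqrt_eq_rpow]
  simpa using key

theorem intervalIntegrable_abs_sub_rpow {s : ℝ} (hs : -1 < s) (c a b : ℝ) :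
    IntervalIntegrable (fun x : ℝ => |x - c| ^ s) volume a b := by
  have pos : ∀ d : ℝ, 0 ≤ d → IntervalIntegrable (fun x : ℝ => |x| ^ s) volume 0 d := fun d hd =>
    (intervalIntegral.intervalIntegrable_rpow' (a := 0) (b := d) hs).congr fun x hx => by
      rw [Set.uIoc_of_le hd] at hx
      simp only [abs_of_pos hx.1]
  have all : ∀ d : ℝ, IntervalIntegrable (fun x : ℝ => |x| ^ s) volume 0 d := fun d => by
    rcases le_total 0 d with hd | hd
    · exact pos d hd
    · simpa using ((IntervalIntegrable.iff_comp_neg (by simp)).1 (pos (-d) (by linarith)))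
  have := ((all (a - c)).symm.trans (all (b - c))).comp_sub_right c
  simpa using this

/-- The range `t ≤ 2` covers `|cos θ - α|`. Any exponent above `-1/4` would serve: squaring the
logarithm and the quadratic vanishing of `cos θ - α` at `α = ±1` together multiply it by four. -/
theorem abs_log_le_rpow {t : ℝ} (h0 : 0 < t) (h2 : t ≤ 2) :
    |Real.log t| ≤ 8 * t ^ (-(1 / 8) : ℝ) := by
  rcases le_total t 1 with h1 | h1
  · have := (Real.abs_log_mul_self_rpow_lt t (1 / 8) h0 h1 (by norm_num)).le
    rw [abs_mul, abs_of_pos (Real.rpow_pos_of_pos h0 _)] at this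
    rw [Real.rpow_neg h0.le, ← div_eq_mul_inv, le_div_iff₀ (Real.rpow_pos_of_pos h0 _)]
    linarith
  · have a1 : |Real.log t| ≤ 1 := by
      rw [abs_of_nonneg (Real.log_nonneg h1)]
      linarith [Real.log_le_sub_one_of_pos h0]
    have a2 : (1 : ℝ) / 2 ≤ t ^ (-(1 / 8) : ℝ) := by
      calc (1 : ℝ) / 2 = 2 ^ (-1 : ℝ) := by rw [Real.rpow_neg_one]; norm_num
        _ ≤ 2 ^ (-(1 / 8) : ℝ) := Real.rpow_le_rpow_of_exponent_le (by norm_num) (by norm_num)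
        _ ≤ t ^ (-(1 / 8) : ℝ) := Real.rpow_le_rpow_of_nonpos h0 h2 (by norm_num)
    linarith

/-- Write the difference as `2 sin((x+y)/2) sin((x-y)/2)` with `y ≤ x`. On `[0, π]` the first sine
dominates the second, and Jordan's inequality bounds the second below. A quadratic bound is the best
possible uniformly, because cosine is stationary at `0` and `π`. -/
theorem sq_abs_sub_div_three_le_abs_cos_sub_cos {x y : ℝ} (hx : x ∈ Set.Icc 0 π)
    (hy : y ∈ Set.Icc 0 π) : (|x - y| / 3) ^ 2 ≤ |Real.cos x - Real.cos y| := by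
  wlog hxy : y ≤ x generalizing x y
  · rw [abs_sub_comm x, abs_sub_comm (Real.cos x)]
    exact this hy hx (le_of_not_ge hxy)
  obtain ⟨hx0, hx1⟩ := hx
  obtain ⟨hy0, hy1⟩ := hy
  have hd : 0 ≤ (x - y) / 2 := by linarith
  have hs1 : 2 / π * ((x - y) / 2) ≤ Real.sin ((x - y) / 2) :=
    Real.mul_le_sin hd (by linarith)
  have hs2 : Real.sin ((x - y) / 2) ≤ Real.sin ((x + y) / 2) := by
    rcases le_total ((x + y) / 2) (π / 2) with h | h
    · exact Real.sin_le_sin_of_le_of_le_pi_div_two (by linarith [Real.pi_pos]) h (by linarith)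
    · rw [← Real.sin_pi_sub ((x + y) / 2)]
      exact Real.sin_le_sin_of_le_of_le_pi_div_two (by linarith [Real.pi_pos]) (by linarith)
        (by linarith)
  have h0 : (0 : ℝ) ≤ 2 / π * ((x - y) / 2) := by positivity
  have hs0 : 0 ≤ Real.sin ((x - y) / 2) := h0.trans hs1
  rw [Real.cos_sub_cos, abs_of_nonneg (sub_nonneg.2 hxy), abs_mul, abs_mul,
    abs_of_nonneg hs0, abs_of_nonneg (hs0.trans hs2)]
  norm_num
  have e1 : (x - y) / 3 / 2 ≤ 2 / π * ((x - y) / 2) := by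
    have : (1 : ℝ) / 3 ≤ 2 / π := by
      rw [div_le_div_iff₀ (by norm_num) Real.pi_pos]; linarith [Real.pi_lt_four]
    nlinarith
  have h1 : (1 / 3 : ℝ) ^ 2 * (x - y) ^ 2 ≤ 2 * (2 / π * ((x - y) / 2)) ^ 2 := by
    have : (1 / 3 : ℝ) ^ 2 ≤ 2 * (1 / π) ^ 2 := by
      rw [one_div_pow, one_div_pow, mul_one_div, div_le_div_iff₀ (by norm_num) (by positivity)]
      nlinarith [Real.pi_lt_four, Real.pi_pos]
    calc _ ≤ 2 * (1 / π) ^ 2 * (x - y) ^ 2 := by gcongr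
      _ = _ := by ring
  calc ((x - y) / 3) ^ 2 = (1 / 3 : ℝ) ^ 2 * (x - y) ^ 2 := by ring
    _ ≤ _ := h1
    _ ≤ 2 * (Real.sin ((x - y) / 2)) ^ 2 := by gcongr
    _ ≤ _ := by nlinarith

theorem log_sq_eq (x α : ℝ) : Real.log ((x - α) ^ 2) = 2 * Real.log (x - α) := by
  rw [Real.log_pow]; norm_num

/-- The `L²(0, π)` norm of `θ ↦ log((cos θ - α)²)`. -/
noncomputable def logNorm (α : ℝ) : ℝ :=
  √(∫ θ in (0 : ℝ)..π, |Real.log ((Real.cos θ - α) ^ 2)| ^ 2)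

theorem intervalIntegrable_sq_log_cos_sub {α : ℝ} (hα : α ∈ Set.Icc (-1 : ℝ) 1) :
    IntervalIntegrable (fun θ => |Real.log ((Real.cos θ - α) ^ 2)| ^ 2) volume 0 π := by
  have hc : Real.cos (Real.arccos α) = α := Real.cos_arccos hα.1 hα.2
  have hm : Real.arccos α ∈ Set.Icc 0 π := ⟨Real.arccos_nonneg α, Real.arccos_le_pi α⟩
  refine ((intervalIntegrable_abs_sub_rpow (s := -(1 / 2)) (by norm_num)
    (Real.arccos α) 0 π).const_mul (512 : ℝ)).mono_fun
    (Measurable.aestronglyMeasurable (by fun_prop)) ?_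
  filter_upwards [ae_restrict_mem measurableSet_uIoc,
    (MeasureTheory.compl_mem_ae_iff.2 (measure_singleton (Real.arccos α))
      |> (ae_restrict_of_ae (s := Set.uIoc 0 π)))] with θ hθ hne
  rw [Set.uIoc_of_le Real.pi_pos.le] at hθ
  have hθ' : θ ∈ Set.Icc 0 π := ⟨hθ.1.le, hθ.2⟩
  have hd : 0 < |θ - Real.arccos α| := abs_pos.2 (sub_ne_zero.2 hne)
  have hlow := sq_abs_sub_div_three_le_abs_cos_sub_cos hθ' hm
  rw [hc] at hlow
  set d := |θ - Real.arccos α|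
  set t := |Real.cos θ - α| with ht
  have ht0 : 0 < t := lt_of_lt_of_le (by positivity) hlow
  have ht2 : t ≤ 2 := by
    rw [ht, abs_le]
    constructor <;> linarith [hα.1, hα.2, Real.cos_le_one θ, Real.neg_one_le_cos θ]
  have e : |Real.log ((Real.cos θ - α) ^ 2)| ≤ 16 * t ^ (-(1 / 8) : ℝ) := by
    rw [log_sq_eq, abs_mul, ← Real.log_abs (Real.cos θ - α), abs_of_pos (by norm_num : (0 : ℝ) < 2)]
    linarith [abs_log_le_rpow ht0 ht2]
  -- Squaring turns `-1/8` into `-1/4`, and `t ≥ (d/3)²` turns that into the integrable power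
  -- `d^{-1/2}`.
  have e2 : (t ^ (-(1 / 8) : ℝ)) ^ 2 ≤ 2 * d ^ (-(1 / 2) : ℝ) := by
    calc (t ^ (-(1 / 8) : ℝ)) ^ 2 = t ^ (-(1 / 4) : ℝ) := by
          rw [← Real.rpow_natCast, ← Real.rpow_mul ht0.le]; norm_num
      _ ≤ ((d / 3) ^ 2) ^ (-(1 / 4) : ℝ) :=
          Real.rpow_le_rpow_of_nonpos (by positivity) hlow (by norm_num)
      _ = (d / 3) ^ (-(1 / 2) : ℝ) := by
          rw [← Real.rpow_natCast, ← Real.rpow_mul (by positivity)]; norm_num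
      _ = d ^ (-(1 / 2) : ℝ) * √3 := by
          rw [Real.div_rpow hd.le (by norm_num), Real.rpow_neg (by norm_num : (0:ℝ) ≤ 3),
            div_inv_eq_mul, Real.sqrt_eq_rpow]
      _ ≤ _ := by
          have : √3 ≤ 2 := Real.sqrt_le_iff.2 (by norm_num)
          have := Real.rpow_nonneg hd.le (-(1 / 2) : ℝ)
          nlinarith
  rw [Real.norm_of_nonneg (by positivity), Real.norm_of_nonneg (by positivity)]
  calc _ ≤ (16 * t ^ (-(1 / 8) : ℝ)) ^ 2 := by gcongr
    _ = 256 * (t ^ (-(1 / 8) : ℝ)) ^ 2 := by ring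
    _ ≤ 256 * (2 * d ^ (-(1 / 2) : ℝ)) := by gcongr
    _ = _ := by ring

theorem integral_mul_log_cos_sub_le {α : ℝ} (hα : α ∈ Set.Icc (-1 : ℝ) 1) {u : ℝ → ℝ}
    (hu : Continuous u) (hu0 : ∀ θ, 0 ≤ u θ) :
    IntervalIntegrable (fun θ => u θ * |Real.log ((Real.cos θ - α) ^ 2)|) volume 0 π ∧
    ∫ θ in (0 : ℝ)..π, u θ * |Real.log ((Real.cos θ - α) ^ 2)| ≤
      √(∫ θ in (0 : ℝ)..π, u θ ^ 2) * logNorm α :=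
  integral_mul_le_sqrt_mul_sqrt Real.pi_pos.le hu0 (fun _ => abs_nonneg _) hu.measurable
    (by fun_prop) (Continuous.intervalIntegrable (by fun_prop) _ _)
    (intervalIntegrable_sq_log_cos_sub hα)

theorem intervalIntegrable_log_sq (α a b : ℝ) :
    IntervalIntegrable (fun x : ℝ => Real.log ((x - α) ^ 2)) volume a b := by
  simp only [log_sq_eq]
  have := (intervalIntegral.intervalIntegrable_log' (a := a - α) (b := b - α)).comp_sub_right α
  simpa using this.const_mul 2

theorem norm_cexp_I_mul_mul (k x : ℝ) : ‖Complex.exp (Complex.I * k * x)‖ = 1 := by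
  rw [Complex.norm_exp]; simp

/-! ### Bounds by the norms of `p(cos θ)` and of its derivative. -/

/-- The `L²(0, π)` norm of `θ ↦ p(cos θ)`. -/
noncomputable def valNorm (p : ℂ[X]) : ℝ :=
  √(∫ θ in (0 : ℝ)..π, ‖p.eval ((Real.cos θ : ℝ) : ℂ)‖ ^ 2)

/-- The `L²(0, π)` norm of the derivative of `θ ↦ p(cos θ)`. -/
noncomputable def derivNorm (p : ℂ[X]) : ℝ :=
  √(∫ θ in (0 : ℝ)..π, (‖p.derivative.eval ((Real.cos θ : ℝ) : ℂ)‖ * |Real.sin θ|) ^ 2)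

theorem derivNorm_nonneg (p : ℂ[X]) : 0 ≤ derivNorm p := Real.sqrt_nonneg _

theorem logNorm_nonneg (α : ℝ) : 0 ≤ logNorm α := Real.sqrt_nonneg _

@[fun_prop]
theorem continuous_eval_ofReal (p : ℂ[X]) : Continuous fun x : ℝ => p.eval (x : ℂ) :=
  p.continuous.comp Complex.continuous_ofReal

theorem hasDerivAt_eval_ofReal (p : ℂ[X]) (x : ℝ) :
    HasDerivAt (fun x : ℝ => p.eval (x : ℂ)) (p.derivative.eval (x : ℂ)) x :=
  (p.hasDerivAt (x : ℂ)).comp_ofReal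

theorem intervalIntegrable_mul_log {f : ℝ → ℂ} {a b : ℝ} (hf : ContinuousOn f (Set.uIcc a b))
    (α : ℝ) :
    IntervalIntegrable (fun x => f x * (Real.log ((x - α) ^ 2) : ℂ)) volume a b :=
  (show IntervalIntegrable (fun x => ((Real.log ((x - α) ^ 2) : ℝ) : ℂ)) volume a b from
    ⟨(intervalIntegrable_log_sq α a b).1.ofReal,
      (intervalIntegrable_log_sq α a b).2.ofReal⟩).continuousOn_mul hf

theorem intervalIntegrable_osc {f : ℝ → ℂ} {a b : ℝ} (hf : ContinuousOn f (Set.uIcc a b))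
    (α k : ℝ) :
    IntervalIntegrable (fun x => f x * (Real.log ((x - α) ^ 2) : ℂ) *
      Complex.exp (Complex.I * k * x)) volume a b :=
  (intervalIntegrable_mul_log hf α).mul_continuousOn (by fun_prop)

theorem norm_integral_mul_cexp_le {a b : ℝ} (hab : a ≤ b) (k : ℝ) (f : ℝ → ℂ) :
    ‖∫ x in a..b, f x * Complex.exp (Complex.I * k * x)‖ ≤ ∫ x in a..b, ‖f x‖ := by
  refine (intervalIntegral.norm_integral_le_integral_norm hab).trans_eq ?_
  simp [norm_cexp_I_mul_mul]

theorem norm_oscIntegral_le_valNorm {α : ℝ} (hα : α ∈ Set.Icc (-1 : ℝ) 1) (k : ℝ) (p : ℂ[X]) :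
    ‖oscIntegral α k (fun x => p.eval (x : ℂ))‖ ≤ valNorm p * logNorm α := by
  have key := integral_mul_log_cos_sub_le hα
    (u := fun θ => ‖p.eval ((Real.cos θ : ℝ) : ℂ)‖) (by fun_prop) (fun _ => norm_nonneg _)
  refine (norm_integral_mul_cexp_le (by norm_num) k _).trans ?_
  rw [integral_comp_cos]
  refine le_trans ?_ key.2
  refine intervalIntegral.integral_mono_on_of_le_Ioo Real.pi_pos.le
    ((key.1.continuousOn_mul (g := Real.sin) (by fun_prop)).congr fun θ _ => ?_) key.1
      fun θ hθ => ?_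
  · simp only [norm_mul, Complex.norm_real, Real.norm_eq_abs, smul_eq_mul]
  · simp only [norm_mul, Complex.norm_real, Real.norm_eq_abs, smul_eq_mul]
    exact mul_le_of_le_one_left (by positivity) (Real.sin_le_one θ)

/-- The Jacobian `sin θ` is exactly the factor that turns `p'(cos θ)` into the `θ`-derivative of
`p(cos θ)`, so no loss occurs near the endpoints. -/
theorem integral_norm_derivative_mul_log_le {α : ℝ} (hα : α ∈ Set.Icc (-1 : ℝ) 1) (p : ℂ[X]) :
    ∫ x in (-1 : ℝ)..1, ‖p.derivative.eval (x : ℂ)‖ * |Real.log ((x - α) ^ 2)| ≤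
      derivNorm p * logNorm α := by
  have key := integral_mul_log_cos_sub_le hα
    (u := fun θ => ‖p.derivative.eval ((Real.cos θ : ℝ) : ℂ)‖ * |Real.sin θ|) (by fun_prop)
    (fun _ => by positivity)
  rw [integral_comp_cos]
  refine le_trans (le_of_eq ?_) key.2
  refine intervalIntegral.integral_congr fun θ hθ => ?_
  rw [Set.uIcc_of_le Real.pi_pos.le] at hθ
  simp only [smul_eq_mul, abs_of_nonneg (Real.sin_nonneg_of_nonneg_of_le_pi hθ.1 hθ.2)]
  ring

theorem integral_deriv_le_derivNorm (p : ℂ[X]) {a b : ℝ} (ha : 0 ≤ a) (hab : a ≤ b) (hb : b ≤ π) :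
    ∫ θ in a..b, ‖p.derivative.eval ((Real.cos θ : ℝ) : ℂ)‖ * |Real.sin θ| ≤
      derivNorm p * √(b - a) := by
  have key := (integral_mul_le_sqrt_mul_sqrt hab
    (f := fun θ => ‖p.derivative.eval ((Real.cos θ : ℝ) : ℂ)‖ * |Real.sin θ|) (g := fun _ => 1)
    (fun _ => by positivity) (fun _ => zero_le_one)
    (Continuous.measurable (by fun_prop)) measurable_const
    (Continuous.intervalIntegrable (by fun_prop) _ _) (by simp)).2
  simp only [mul_one, one_pow, intervalIntegral.integral_const, smul_eq_mul] at key
  refine key.trans (mul_le_mul_of_nonneg_right (Real.sqrt_le_sqrt ?_) (Real.sqrt_nonneg _))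
  exact intervalIntegral.integral_mono_interval ha hab hb
    (Filter.Eventually.of_forall fun θ => by positivity)
    (Continuous.intervalIntegrable (by fun_prop) _ _)

theorem integral_norm_derivative_le (p : ℂ[X]) :
    ∫ x in (-1 : ℝ)..1, ‖p.derivative.eval (x : ℂ)‖ ≤ derivNorm p * √π := by
  have key := integral_deriv_le_derivNorm p le_rfl Real.pi_pos.le le_rfl
  rw [integral_comp_cos]
  rw [sub_zero] at key
  refine le_trans (le_of_eq ?_) key
  refine intervalIntegral.integral_congr fun θ hθ => ?_
  rw [Set.uIcc_of_le Real.pi_pos.le] at hθ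
  simp only [smul_eq_mul, abs_of_nonneg (Real.sin_nonneg_of_nonneg_of_le_pi hθ.1 hθ.2)]
  ring

/-- The one-dimensional Sobolev embedding of `H¹` into Hölder-`1/2` functions: integrate the
derivative and apply Cauchy–Schwarz. -/
theorem norm_eval_cos_sub_le (p : ℂ[X]) {a b : ℝ} (ha : a ∈ Set.Icc 0 π) (hb : b ∈ Set.Icc 0 π) :
    ‖p.eval ((Real.cos a : ℝ) : ℂ) - p.eval ((Real.cos b : ℝ) : ℂ)‖ ≤
      derivNorm p * √|a - b| := by
  wlog hab : b ≤ a generalizing a b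
  · rw [norm_sub_rev, abs_sub_comm]
    exact this hb ha (le_of_not_ge hab)
  have hd : ∀ θ : ℝ, HasDerivAt (fun θ : ℝ => p.eval ((Real.cos θ : ℝ) : ℂ))
      ((-Real.sin θ) • p.derivative.eval ((Real.cos θ : ℝ) : ℂ)) θ := fun θ =>
    (hasDerivAt_eval_ofReal p (Real.cos θ)).scomp θ (Real.hasDerivAt_cos θ)
  rw [← intervalIntegral.integral_eq_sub_of_hasDerivAt (fun θ _ => hd θ)
    (Continuous.intervalIntegrable (by fun_prop) _ _), abs_of_nonneg (sub_nonneg.2 hab)]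
  refine (intervalIntegral.norm_integral_le_integral_norm hab).trans
    (le_trans (le_of_eq ?_) (integral_deriv_le_derivNorm p hb.1 hab ha.2))
  simp only [norm_smul, norm_neg, Real.norm_eq_abs, mul_comm]

/-- The Hölder exponent `1/2` in `θ` drops to `1/4` in `x`, since `|arccos x - arccos y| ≤ 3 |x -
y|^{1/2}`. -/
theorem norm_eval_sub_le (p : ℂ[X]) {x y : ℝ} (hx : x ∈ Set.Icc (-1 : ℝ) 1)
    (hy : y ∈ Set.Icc (-1 : ℝ) 1) :
    ‖p.eval (x : ℂ) - p.eval (y : ℂ)‖ ≤ 2 * derivNorm p * |x - y| ^ (1 / 4 : ℝ) := by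
  have ha : Real.arccos x ∈ Set.Icc 0 π := ⟨Real.arccos_nonneg x, Real.arccos_le_pi x⟩
  have hb : Real.arccos y ∈ Set.Icc 0 π := ⟨Real.arccos_nonneg y, Real.arccos_le_pi y⟩
  have h1 := norm_eval_cos_sub_le p ha hb
  have h2 := sq_abs_sub_div_three_le_abs_cos_sub_cos ha hb
  rw [Real.cos_arccos hx.1 hx.2, Real.cos_arccos hy.1 hy.2] at h1 h2
  have h3 : √|Real.arccos x - Real.arccos y| ≤ 2 * |x - y| ^ (1 / 4 : ℝ) := by
    have h4 := Real.sqrt_le_sqrt h2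
    rw [Real.sqrt_sq (by positivity)] at h4
    calc √|Real.arccos x - Real.arccos y| ≤ √(2 ^ 2 * √|x - y|) :=
          Real.sqrt_le_sqrt (by linarith [Real.sqrt_nonneg |x - y|])
      _ = 2 * √√|x - y| := by
          rw [Real.sqrt_mul (by norm_num), Real.sqrt_sq (by norm_num)]
      _ = _ := by
          rw [Real.sqrt_eq_rpow, Real.sqrt_eq_rpow, ← Real.rpow_mul (abs_nonneg _)]; norm_num
  calc _ ≤ _ := h1
    _ ≤ derivNorm p * (2 * |x - y| ^ (1 / 4 : ℝ)) :=
        mul_le_mul_of_nonneg_left h3 (derivNorm_nonneg p)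
    _ = _ := by ring

/-- Hölder continuity with exponent `1/4` leaves the singularity `|x - α|^{-3/4}` in the divided
difference, which is integrable. This is what lets one integration by parts cost no more than
`derivNorm`. -/
theorem integral_norm_divided_difference_le {α : ℝ} (hα : α ∈ Set.Icc (-1 : ℝ) 1) {p h : ℂ[X]}
    (hp : ∀ x : ℝ, p.eval (x : ℂ) - p.eval (α : ℂ) = (x - α) * h.eval (x : ℂ)) :
    ∫ x in (-1 : ℝ)..1, ‖h.eval (x : ℂ)‖ ≤
      2 * derivNorm p * ∫ x in (-1 : ℝ)..1, |x - α| ^ (-(3 / 4) : ℝ) := by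
  rw [← intervalIntegral.integral_const_mul]
  refine intervalIntegral.integral_mono_ae_restrict (by norm_num)
    (Continuous.intervalIntegrable (by fun_prop) _ _)
    ((intervalIntegrable_abs_sub_rpow (by norm_num) _ _ _).const_mul _) ?_
  filter_upwards [ae_restrict_mem measurableSet_Icc, (compl_mem_ae_iff.2 (measure_singleton α)
      |> (ae_restrict_of_ae (s := Set.Icc (-1 : ℝ) 1)))] with x hx hne
  have hpos : 0 < |x - α| := abs_pos.2 (sub_ne_zero.2 hne)
  have h1 := norm_eval_sub_le p hx hα
  rw [hp x, norm_mul, ← Complex.ofReal_sub, Complex.norm_real, Real.norm_eq_abs] at h1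
  have h2 : |x - α| ^ (1 / 4 : ℝ) = |x - α| * |x - α| ^ (-(3 / 4) : ℝ) := by
    rw [← Real.rpow_one_add' hpos.le (by norm_num)]; norm_num
  rw [h2] at h1
  exact le_of_mul_le_mul_left (by linarith) hpos

/-! ### Integration by parts against the logarithm. -/

theorem hasDerivAt_cexp (k x : ℝ) :
    HasDerivAt (fun x : ℝ => Complex.exp (Complex.I * k * x))
      (Complex.exp (Complex.I * k * x) * (Complex.I * k)) x := by
  have : HasDerivAt (fun z : ℂ => Complex.exp (Complex.I * k * z))
      (Complex.exp (Complex.I * k * x) * (Complex.I * k * 1)) (x : ℂ) :=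
    ((hasDerivAt_id (x : ℂ)).const_mul (Complex.I * k)).cexp
  simpa using this.comp_ofReal

/-- Because `q` vanishes at `α`, the product of `q` and the logarithm is continuous there, so the
fundamental theorem applies with the single exceptional point `α`. Differentiating the logarithm
gives `2/(x - α)`, which `q` cancels down to `2h`. -/
theorem integral_by_parts_log {α : ℝ} (k : ℝ) {q h : ℂ[X]}
    (hq : ∀ x : ℝ, q.eval (x : ℂ) = (x - α) * h.eval (x : ℂ)) :
    Complex.I * k * oscIntegral α k (fun x => q.eval (x : ℂ)) =
      q.eval 1 * (Real.log ((1 - α) ^ 2) : ℂ) * Complex.exp (Complex.I * k) -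
      q.eval (-1) * (Real.log ((-1 - α) ^ 2) : ℂ) * Complex.exp (-(Complex.I * k)) -
      (oscIntegral α k (fun x => q.derivative.eval (x : ℂ)) +
        2 * ∫ x in (-1 : ℝ)..1, h.eval (x : ℂ) * Complex.exp (Complex.I * k * x)) := by
  set F : ℝ → ℂ := fun x =>
    q.eval (x : ℂ) * (Real.log ((x - α) ^ 2) : ℂ) * Complex.exp (Complex.I * k * x) with hF
  set F' : ℝ → ℂ := fun x =>
    (q.derivative.eval (x : ℂ) * (Real.log ((x - α) ^ 2) : ℂ) * Complex.exp (Complex.I * k * x) +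
      2 * (h.eval (x : ℂ) * Complex.exp (Complex.I * k * x))) +
    Complex.I * k *
      (q.eval (x : ℂ) * (Real.log ((x - α) ^ 2) : ℂ) * Complex.exp (Complex.I * k * x)) with hF'
  have i1 := intervalIntegrable_osc (a := -1) (b := 1)
    (continuous_eval_ofReal q.derivative).continuousOn α k
  have i2 : IntervalIntegrable (fun x : ℝ => 2 * (h.eval (x : ℂ) *
    Complex.exp (Complex.I * k * x))) volume (-1) 1 :=
    Continuous.intervalIntegrable (by fun_prop) _ _
  have i3 := (intervalIntegrable_osc (a := -1) (b := 1)
    (continuous_eval_ofReal q).continuousOn α k).const_mul (Complex.I * k)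
  have hc : Continuous F := by
    have e : F = fun x : ℝ => h.eval (x : ℂ) *
        ((2 * ((x - α) * Real.log (x - α)) : ℝ) : ℂ) * Complex.exp (Complex.I * k * x) := by
      funext x
      simp only [hF, hq, log_sq_eq]
      push_cast
      ring
    rw [e]
    have hl : Continuous fun x : ℝ => (x - α) * Real.log (x - α) :=
      Real.continuous_mul_log.comp (continuous_id.sub continuous_const)
    fun_prop
  have hd : ∀ x ∈ Set.Ioo (-1 : ℝ) 1 \ {α}, HasDerivAt F (F' x) x := by
    rintro x ⟨-, hx⟩
    have hx0 : x - α ≠ 0 := sub_ne_zero.2 hx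
    have d1 : HasDerivAt (fun x : ℝ => ((Real.log ((x - α) ^ 2) : ℝ) : ℂ))
        ((2 * (x - α)⁻¹ : ℝ) : ℂ) x := by
      refine HasDerivAt.ofReal_comp ?_
      simp only [log_sq_eq]
      simpa using (((hasDerivAt_id x).sub_const α).log hx0).const_mul 2
    have := ((hasDerivAt_eval_ofReal q x).mul d1).mul (hasDerivAt_cexp k x)
    refine this.congr_deriv ?_
    have hx0' : ((x : ℂ) - α) ≠ 0 := by exact_mod_cast hx0
    simp only [hF', Pi.mul_apply]
    rw [hq x]
    generalize Real.log ((x - α) ^ 2) = l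
    push_cast
    field_simp
  have ftc := integral_eq_of_hasDerivAt_off_countable_of_le F F' (by norm_num)
    (Set.countable_singleton α) hc.continuousOn hd ((i1.add i2).add i3)
  rw [hF', intervalIntegral.integral_add (i1.add i2) i3, intervalIntegral.integral_add i1 i2,
    intervalIntegral.integral_const_mul, intervalIntegral.integral_const_mul] at ftc
  simp only [hF] at ftc
  simp only [oscIntegral]
  push_cast at ftc ⊢
  rw [mul_one, mul_neg, mul_one] at ftc
  linear_combination ftc

theorem norm_oscIntegral_derivative_le {α : ℝ} (hα : α ∈ Set.Icc (-1 : ℝ) 1) (k : ℝ) (p : ℂ[X]) :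
    ‖oscIntegral α k (fun x => p.derivative.eval (x : ℂ))‖ ≤ derivNorm p * logNorm α := by
  refine (norm_integral_mul_cexp_le (by norm_num) k _).trans
    (le_trans (le_of_eq ?_) (integral_norm_derivative_mul_log_le hα p))
  simp only [norm_mul, Complex.norm_real, Real.norm_eq_abs]

theorem exists_divided_difference (p : ℂ[X]) (α : ℝ) :
    ∃ h : ℂ[X], ∀ x : ℝ, p.eval (x : ℂ) - p.eval (α : ℂ) = (x - α) * h.eval (x : ℂ) := by
  obtain ⟨h, hh⟩ := Polynomial.X_sub_C_dvd_sub_C_eval (p := p) (a := (α : ℂ))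
  refine ⟨h, fun x => ?_⟩
  have := congrArg (Polynomial.eval (x : ℂ)) hh
  simpa using this

theorem norm_eval_sub_le_derivNorm (p : ℂ[X]) {x y : ℝ} (hx : x ∈ Set.Icc (-1 : ℝ) 1)
    (hy : y ∈ Set.Icc (-1 : ℝ) 1) :
    ‖p.eval (x : ℂ) - p.eval (y : ℂ)‖ ≤ 4 * derivNorm p := by
  have h1 : |x - y| ^ (1 / 4 : ℝ) ≤ 2 := by
    have h2 : |x - y| ≤ 2 := by
      rw [abs_le]; constructor <;> linarith [hx.1, hx.2, hy.1, hy.2]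
    calc |x - y| ^ (1 / 4 : ℝ) ≤ 2 ^ (1 / 4 : ℝ) :=
          Real.rpow_le_rpow (abs_nonneg _) h2 (by norm_num)
      _ ≤ 2 ^ (1 : ℝ) := Real.rpow_le_rpow_of_exponent_le (by norm_num) (by norm_num)
      _ = 2 := by norm_num
  nlinarith [norm_eval_sub_le p hx hy, derivNorm_nonneg p]

theorem oscIntegral_sub {f g : ℝ → ℂ} (hf : ContinuousOn f (Set.Icc (-1) 1))
    (hg : ContinuousOn g (Set.Icc (-1) 1)) (α k : ℝ) :
    oscIntegral α k (fun x => f x - g x) = oscIntegral α k f - oscIntegral α k g := by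
  have e : Set.uIcc (-1 : ℝ) 1 = Set.Icc (-1) 1 := Set.uIcc_of_le (by norm_num)
  rw [oscIntegral, oscIntegral, oscIntegral, ← intervalIntegral.integral_sub
    (intervalIntegrable_osc (e ▸ hf) α k) (intervalIntegrable_osc (e ▸ hg) α k)]
  simp only [sub_mul]

theorem oscIntegral_add {f g : ℝ → ℂ} (hf : ContinuousOn f (Set.Icc (-1) 1))
    (hg : ContinuousOn g (Set.Icc (-1) 1)) (α k : ℝ) :
    oscIntegral α k (fun x => f x + g x) = oscIntegral α k f + oscIntegral α k g := by
  have e : Set.uIcc (-1 : ℝ) 1 = Set.Icc (-1) 1 := Set.uIcc_of_le (by norm_num)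
  rw [oscIntegral, oscIntegral, oscIntegral, ← intervalIntegral.integral_add
    (intervalIntegrable_osc (e ▸ hf) α k) (intervalIntegrable_osc (e ▸ hg) α k)]
  simp only [add_mul]

theorem oscIntegral_const_mul (c : ℂ) (f : ℝ → ℂ) (α k : ℝ) :
    oscIntegral α k (fun x => c * f x) = c * oscIntegral α k f := by
  rw [oscIntegral, oscIntegral, ← intervalIntegral.integral_const_mul]
  simp only [mul_assoc]

/-- Integrate `p - p(α)` by parts. Boundary values, the derivative term and the divided difference
are each controlled by `derivNorm p`, and the constant depends on `α` only. -/
theorem norm_oscIntegral_sub_le {α : ℝ} (hα : α ∈ Set.Icc (-1 : ℝ) 1) :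
    ∃ C : ℝ, 0 ≤ C ∧ ∀ (k : ℝ) (p : ℂ[X]), 0 < k →
      ‖oscIntegral α k (fun x => p.eval (x : ℂ)) -
        p.eval (α : ℂ) * oscIntegral α k (fun _ => 1)‖ ≤ C / k * derivNorm p := by
  refine ⟨4 * |Real.log ((1 - α) ^ 2)| + 4 * |Real.log ((-1 - α) ^ 2)| + logNorm α +
    4 * ∫ x in (-1 : ℝ)..1, |x - α| ^ (-(3 / 4) : ℝ), ?_, fun k p hk => ?_⟩
  · have : 0 ≤ ∫ x in (-1 : ℝ)..1, |x - α| ^ (-(3 / 4) : ℝ) :=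
      intervalIntegral.integral_nonneg (by norm_num) fun x _ => by positivity
    have := logNorm_nonneg α
    positivity
  obtain ⟨h, hh⟩ := exists_divided_difference p α
  set q : ℂ[X] := p - C (p.eval (α : ℂ)) with hq
  have hqe : ∀ z : ℂ, q.eval z = p.eval z - p.eval (α : ℂ) := fun z => by simp [hq]
  have hqd : q.derivative = p.derivative := by simp [hq]
  have key := integral_by_parts_log k (q := q) (h := h) (fun x => by rw [hqe, hh])
  have e : oscIntegral α k (fun x => p.eval (x : ℂ)) -
      p.eval (α : ℂ) * oscIntegral α k (fun _ => 1) =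
      oscIntegral α k (fun x => q.eval (x : ℂ)) := by
    simp only [hqe]
    rw [oscIntegral_sub (by fun_prop) (by fun_prop), ← oscIntegral_const_mul]
    simp only [mul_one]
  rw [e]
  have b1 : ‖q.eval 1‖ ≤ 4 * derivNorm p := by
    have := norm_eval_sub_le_derivNorm p (x := 1) (by norm_num) hα
    rwa [hqe, ← Complex.ofReal_one]
  have b2 : ‖q.eval (-1)‖ ≤ 4 * derivNorm p := by
    have := norm_eval_sub_le_derivNorm p (x := -1) (by norm_num) hα
    rw [hqe]; simpa using this
  have b3 := norm_oscIntegral_derivative_le hα k p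
  have b4 := (norm_integral_mul_cexp_le (by norm_num) k (fun x : ℝ => h.eval (x : ℂ))).trans
    (integral_norm_divided_difference_le hα hh)
  have n1 : ‖Complex.exp (Complex.I * k)‖ = 1 := by
    simpa only [Complex.ofReal_one, mul_one] using norm_cexp_I_mul_mul k 1
  have n2 : ‖Complex.exp (-(Complex.I * k))‖ = 1 := by simpa using norm_cexp_I_mul_mul k (-1)
  have n := congrArg norm key
  rw [norm_mul, norm_mul, Complex.norm_I, Complex.norm_real, Real.norm_eq_abs, abs_of_pos hk,
    one_mul, hqd] at n
  rw [div_mul_eq_mul_div, le_div_iff₀ hk, mul_comm, n]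
  refine (norm_sub_le _ _).trans ?_
  refine (add_le_add (norm_sub_le _ _) (norm_add_le _ _)).trans ?_
  simp only [norm_mul, n1, n2, mul_one, Complex.norm_real, Real.norm_eq_abs, Complex.norm_two]
  have c1 := mul_le_mul_of_nonneg_right b1 (abs_nonneg (Real.log ((1 - α) ^ 2)))
  have c2 := mul_le_mul_of_nonneg_right b2 (abs_nonneg (Real.log ((-1 - α) ^ 2)))
  linarith

/-! ### The oscillatory integral of the bare weight. -/

theorem abs_integral_sinc_le {x : ℝ} (hx : 0 ≤ x) : |∫ u in (0 : ℝ)..x, Real.sinc u| ≤ 3 := by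
  have hi : ∀ a b : ℝ, IntervalIntegrable Real.sinc volume a b := fun a b =>
    Real.continuous_sinc.intervalIntegrable a b
  rcases le_total x 1 with h1 | h1
  · have := intervalIntegral.norm_integral_le_of_norm_le_const (a := 0) (b := x) (C := 1)
      (f := Real.sinc) fun u _ => by simpa using Real.abs_sinc_le_one u
    rw [Real.norm_eq_abs, sub_zero, abs_of_nonneg hx] at this
    linarith
  · have a1 : |∫ u in (0 : ℝ)..1, Real.sinc u| ≤ 1 := by
      have := intervalIntegral.norm_integral_le_of_norm_le_const (a := 0) (b := 1) (C := 1)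
        (f := Real.sinc) fun u _ => by simpa using Real.abs_sinc_le_one u
      simpa using this
    have hne : ∀ u ∈ Set.uIcc 1 x, u ≠ 0 := fun u hu => by
      rw [Set.uIcc_of_le h1] at hu; linarith [hu.1]
    have c2 : ContinuousOn (fun u : ℝ => Real.cos u / u ^ 2) (Set.uIcc 1 x) :=
      Real.continuous_cos.continuousOn.div (by fun_prop) fun u hu => pow_ne_zero 2 (hne u hu)
    have ftc := intervalIntegral.integral_eq_sub_of_hasDerivAt (a := 1) (b := x)
      (f := fun u => -Real.cos u / u) (f' := fun u => Real.sinc u + Real.cos u / u ^ 2)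
      (fun u hu => by
        have h0 := hne u hu
        refine ((Real.hasDerivAt_cos u).neg.div (hasDerivAt_id u) h0).congr_deriv ?_
        rw [Real.sinc_of_ne_zero h0]
        simp only [id, Pi.neg_apply]
        field_simp
        ring) ((hi 1 x).add c2.intervalIntegrable)
    rw [intervalIntegral.integral_add (hi 1 x) c2.intervalIntegrable] at ftc
    have c3 : ContinuousOn (fun u : ℝ => 1 / u ^ 2) (Set.uIcc 1 x) :=
      continuousOn_const.div (by fun_prop) fun u hu => pow_ne_zero 2 (hne u hu)
    have ftc2 := intervalIntegral.integral_eq_sub_of_hasDerivAt (a := 1) (b := x)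
      (f := fun u => -1 / u) (f' := fun u => 1 / u ^ 2)
      (fun u hu => by
        refine ((hasDerivAt_const u (-1 : ℝ)).div (hasDerivAt_id u) (hne u hu)).congr_deriv ?_
        simp) c3.intervalIntegrable
    have a2 : |∫ u in (1 : ℝ)..x, Real.cos u / u ^ 2| ≤ 1 - 1 / x := by
      refine (intervalIntegral.norm_integral_le_of_norm_le (μ := volume)
        (f := fun u : ℝ => Real.cos u / u ^ 2) h1
        (Filter.Eventually.of_forall fun u hu => ?_) c3.intervalIntegrable).trans_eq ?_
      · rw [Real.norm_eq_abs, abs_div, abs_of_nonneg (sq_nonneg u)]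
        exact div_le_div_of_nonneg_right (Real.abs_cos_le_one u) (sq_nonneg u)
      · rw [ftc2]; ring
    have a3 : |Real.cos x / x| ≤ 1 / x := by
      rw [abs_div, abs_of_pos (by linarith : 0 < x)]
      exact div_le_div_of_nonneg_right (Real.abs_cos_le_one x) (by linarith)
    have a4 := Real.abs_cos_le_one 1
    rw [← intervalIntegral.integral_add_adjacent_intervals (hi 0 1) (hi 1 x)]
    rw [neg_div] at ftc
    -- The total is at most `1 + |cos 1| + 1/x + (1 - 1/x) ≤ 3`.
    simp only [abs_le] at *
    constructor <;> linarith

/-- The divided difference `(exp(ikx) - exp(ikα)) / (x - α)`. -/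
noncomputable def expSlope (α k : ℝ) : ℝ → ℂ :=
  dslope (fun x : ℝ => Complex.exp (Complex.I * k * x)) α

theorem expSlope_same (α k : ℝ) :
    expSlope α k α = Complex.exp (Complex.I * k * α) * (Complex.I * k) := by
  rw [expSlope, dslope_same, (hasDerivAt_cexp k α).deriv]

theorem sub_mul_expSlope (α k x : ℝ) :
    ((x : ℂ) - α) * expSlope α k x =
      Complex.exp (Complex.I * k * x) - Complex.exp (Complex.I * k * α) := by
  have := sub_smul_dslope (fun x : ℝ => Complex.exp (Complex.I * k * x)) α x
  rw [← this, Complex.real_smul, expSlope]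
  push_cast
  rfl

theorem continuous_expSlope (α k : ℝ) : Continuous (expSlope α k) := by
  rw [continuous_iff_continuousAt]
  intro x
  rcases eq_or_ne x α with rfl | h
  · exact continuousAt_dslope_same.2 (hasDerivAt_cexp k x).differentiableAt
  · exact (continuousAt_dslope_of_ne h).2 (hasDerivAt_cexp k x).continuousAt

theorem norm_cexp_sub_cexp_le {k : ℝ} (hk : 0 ≤ k) (α x : ℝ) :
    ‖Complex.exp (Complex.I * k * x) - Complex.exp (Complex.I * k * α)‖ ≤ k * |x - α| := by
  have e : Complex.exp (Complex.I * k * x) - Complex.exp (Complex.I * k * α) =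
      Complex.exp (Complex.I * k * α) * (Complex.exp (Complex.I * (k * (x - α) : ℝ)) - 1) := by
    rw [mul_sub, ← Complex.exp_add, mul_one]
    congr 2
    push_cast
    ring
  rw [e, norm_mul, norm_cexp_I_mul_mul, one_mul]
  refine Real.norm_exp_I_mul_ofReal_sub_one_le.trans_eq ?_
  rw [Real.norm_eq_abs, abs_mul, abs_of_nonneg hk]

theorem norm_cexp_sub_cexp_le_two (k α x : ℝ) :
    ‖Complex.exp (Complex.I * k * x) - Complex.exp (Complex.I * k * α)‖ ≤ 2 := by
  refine (norm_sub_le _ _).trans_eq ?_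
  rw [norm_cexp_I_mul_mul, norm_cexp_I_mul_mul]; norm_num

/-- Combines the bounds `k` (Lipschitz) and `2/|x - α|` (trivial) into one that is continuous in `x`
and has an explicit integral. -/
theorem norm_expSlope_le {k : ℝ} (hk : 0 ≤ k) (α x : ℝ) :
    ‖expSlope α k x‖ ≤ 4 * k / (1 + k * |x - α|) := by
  rcases eq_or_ne x α with rfl | h
  · rw [expSlope_same, norm_mul, norm_cexp_I_mul_mul, norm_mul, Complex.norm_I, Complex.norm_real,
      Real.norm_of_nonneg hk]
    simp only [sub_self, abs_zero, mul_zero, add_zero, div_one, one_mul]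
    linarith
  · have hpos : 0 < |x - α| := abs_pos.2 (sub_ne_zero.2 h)
    have e := congrArg norm (sub_mul_expSlope α k x)
    rw [norm_mul, ← Complex.ofReal_sub, Complex.norm_real, Real.norm_eq_abs] at e
    have h1 := norm_cexp_sub_cexp_le hk α x
    have h2 := norm_cexp_sub_cexp_le_two k α x
    rw [← e] at h1 h2
    set s := ‖expSlope α k x‖
    rw [le_div_iff₀ (by positivity)]
    have h3 : s ≤ k := le_of_mul_le_mul_left (by linarith) hpos
    nlinarith

/-- The constant `1` does not vanish at `α`, so the antiderivative of the exponential is normalised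
to vanish there instead. The product with the logarithm is then continuous, and the remainder is an
integral of `expSlope`. -/
theorem oscIntegral_one_eq (α k : ℝ) :
    Complex.I * k * oscIntegral α k (fun _ => 1) =
      (Real.log ((1 - α) ^ 2) : ℂ) *
        (Complex.exp (Complex.I * k * (1 : ℝ)) - Complex.exp (Complex.I * k * α)) -
      (Real.log ((-1 - α) ^ 2) : ℂ) *
        (Complex.exp (Complex.I * k * (-1 : ℝ)) - Complex.exp (Complex.I * k * α)) -
      2 * ∫ x in (-1 : ℝ)..1, expSlope α k x := by
  set F : ℝ → ℂ := fun x => (Real.log ((x - α) ^ 2) : ℂ) *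
    (Complex.exp (Complex.I * k * x) - Complex.exp (Complex.I * k * α)) with hF
  set F' : ℝ → ℂ := fun x => 2 * expSlope α k x + Complex.I * k *
    (1 * (Real.log ((x - α) ^ 2) : ℂ) * Complex.exp (Complex.I * k * x)) with hF'
  have i1 : IntervalIntegrable (fun x => 2 * expSlope α k x) volume (-1) 1 :=
    ((continuous_expSlope α k).const_mul 2).intervalIntegrable _ _
  have i2 := (intervalIntegrable_osc (a := -1) (b := 1) (f := fun _ => 1)
    continuousOn_const α k).const_mul (Complex.I * k)
  have hc : Continuous F := by
    have e : F = fun x : ℝ => ((2 * ((x - α) * Real.log (x - α)) : ℝ) : ℂ) * expSlope α k x := by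
      funext x
      simp only [hF, ← sub_mul_expSlope, log_sq_eq]
      push_cast
      ring
    rw [e]
    have hl : Continuous fun x : ℝ => (x - α) * Real.log (x - α) :=
      Real.continuous_mul_log.comp (continuous_id.sub continuous_const)
    have := continuous_expSlope α k
    fun_prop
  have hd : ∀ x ∈ Set.Ioo (-1 : ℝ) 1 \ {α}, HasDerivAt F (F' x) x := by
    rintro x ⟨-, hx⟩
    have hx0 : x - α ≠ 0 := sub_ne_zero.2 hx
    have d1 : HasDerivAt (fun x : ℝ => ((Real.log ((x - α) ^ 2) : ℝ) : ℂ))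
        ((2 * (x - α)⁻¹ : ℝ) : ℂ) x := by
      refine HasDerivAt.ofReal_comp ?_
      simp only [log_sq_eq]
      simpa using (((hasDerivAt_id x).sub_const α).log hx0).const_mul 2
    have := d1.mul ((hasDerivAt_cexp k x).sub_const (Complex.exp (Complex.I * k * α)))
    refine this.congr_deriv ?_
    have hx0' : ((x : ℂ) - α) ≠ 0 := by exact_mod_cast hx0
    simp only [hF']
    rw [← sub_mul_expSlope]
    push_cast
    field_simp
  have ftc := integral_eq_of_hasDerivAt_off_countable_of_le F F' (by norm_num)
    (Set.countable_singleton α) hc.continuousOn hd (i1.add i2)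
  rw [hF', intervalIntegral.integral_add i1 i2,
    intervalIntegral.integral_const_mul, intervalIntegral.integral_const_mul] at ftc
  simp only [hF] at ftc
  simp only [oscIntegral]
  linear_combination ftc

theorem norm_mul_oscIntegral_one_le {α k : ℝ} (hk : 0 ≤ k) :
    k * ‖oscIntegral α k (fun _ => 1)‖ ≤
      2 * |Real.log ((1 - α) ^ 2)| + 2 * |Real.log ((-1 - α) ^ 2)| +
        2 * ‖∫ x in (-1 : ℝ)..1, expSlope α k x‖ := by
  have n := congrArg norm (oscIntegral_one_eq α k)
  rw [norm_mul, norm_mul, Complex.norm_I, Complex.norm_real, Real.norm_eq_abs, abs_of_nonneg hk,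
    one_mul] at n
  rw [n]
  refine (norm_sub_le _ _).trans ?_
  refine (add_le_add_left (norm_sub_le _ _) _).trans ?_
  simp only [norm_mul, Complex.norm_real, Real.norm_eq_abs, Complex.norm_two]
  have c1 := mul_le_mul_of_nonneg_left (norm_cexp_sub_cexp_le_two k α 1)
    (abs_nonneg (Real.log ((1 - α) ^ 2)))
  have c2 := mul_le_mul_of_nonneg_left (norm_cexp_sub_cexp_le_two k α (-1))
    (abs_nonneg (Real.log ((-1 - α) ^ 2)))
  linarith

/-- Points symmetric about `α` cancel down to `sin(kt)/t`, whose integral is bounded uniformly in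
`k`; absolute values would lose a logarithm. -/
theorem expSlope_add_expSlope (α k t : ℝ) :
    expSlope α k (α + t) + expSlope α k (α - t) =
      2 * Complex.I * Complex.exp (Complex.I * k * α) * ((k * Real.sinc (k * t) : ℝ) : ℂ) := by
  rcases eq_or_ne t 0 with rfl | ht
  · simp only [add_zero, sub_zero, expSlope_same, mul_zero, Real.sinc_zero]
    push_cast
    ring
  rcases eq_or_ne k 0 with rfl | hk
  · have := norm_expSlope_le le_rfl α (α + t)
    have h1 : expSlope α 0 (α + t) = 0 := by simpa using norm_expSlope_le le_rfl α (α + t)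
    have h2 : expSlope α 0 (α - t) = 0 := by simpa using norm_expSlope_le le_rfl α (α - t)
    simp [h1, h2]
  have ht' : (t : ℂ) ≠ 0 := by exact_mod_cast ht
  have hk' : (k : ℂ) ≠ 0 := by exact_mod_cast hk
  have h1 := sub_mul_expSlope α k (α + t)
  have h2 := sub_mul_expSlope α k (α - t)
  rw [Real.sinc_of_ne_zero (mul_ne_zero hk ht)]
  push_cast at h1 h2 ⊢
  refine mul_left_cancel₀ ht' ?_
  have e1 : Complex.exp (Complex.I * k * (α + t)) =
      Complex.exp (Complex.I * k * α) * Complex.exp (k * t * Complex.I) := by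
    rw [← Complex.exp_add]; congr 1; ring
  have e2 : Complex.exp (Complex.I * k * (α - t)) =
      Complex.exp (Complex.I * k * α) * Complex.exp (-(k * t) * Complex.I) := by
    rw [← Complex.exp_add]; congr 1; ring
  rw [e1] at h1
  rw [e2] at h2
  have e3 : (t : ℂ) * (2 * Complex.I * Complex.exp (Complex.I * k * α) *
      (k * (Complex.sin (k * t) / (k * t)))) =
      Complex.exp (Complex.I * k * α) * (2 * Complex.sin (k * t) * Complex.I) := by
    field_simp
  rw [e3, Complex.two_sin]
  linear_combination h1 - h2 - Complex.exp (Complex.I * k * α) * (Complex.exp (-(k * t) * Complex.I)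
    - Complex.exp (k * t * Complex.I)) * (Complex.I_mul_I)

theorem norm_integral_expSlope_symm_le {k a : ℝ} (hk : 0 ≤ k) (ha : 0 ≤ a) (α : ℝ) :
    ‖∫ x in (α - a)..(α + a), expSlope α k x‖ ≤ 6 := by
  have hc := continuous_expSlope α k
  have hi : ∀ a b : ℝ, IntervalIntegrable (expSlope α k) volume a b := fun a b =>
    hc.intervalIntegrable a b
  have e1 : ∫ x in α..(α + a), expSlope α k x = ∫ t in (0 : ℝ)..a, expSlope α k (α + t) := by
    simp
  have e2 : ∫ x in (α - a)..α, expSlope α k x = ∫ t in (0 : ℝ)..a, expSlope α k (α - t) := by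
    simp
  rw [← intervalIntegral.integral_add_adjacent_intervals (hi (α - a) α) (hi α (α + a)), e1, e2,
    add_comm, ← intervalIntegral.integral_add
      (Continuous.intervalIntegrable (by fun_prop) _ _)
      (Continuous.intervalIntegrable (by fun_prop) _ _)]
  simp only [expSlope_add_expSlope]
  rw [intervalIntegral.integral_const_mul, intervalIntegral.integral_ofReal,
    intervalIntegral.integral_const_mul, intervalIntegral.mul_integral_comp_mul_left, norm_mul,
    norm_mul, norm_cexp_I_mul_mul, norm_mul, Complex.norm_I, Complex.norm_two, Complex.norm_real,
    mul_zero]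
  have := abs_integral_sinc_le (mul_nonneg hk ha)
  rw [Real.norm_eq_abs]
  linarith

theorem norm_integral_expSlope_le_of_far {k a b c α : ℝ} (hc : 0 < c) (hab : a ≤ b)
    (hb : b - a ≤ 2) (hk : 0 ≤ k) (h : ∀ x ∈ Set.Icc a b, c ≤ |x - α|) :
    ‖∫ x in a..b, expSlope α k x‖ ≤ 8 / c := by
  have := intervalIntegral.norm_integral_le_of_norm_le_const (a := a) (b := b) (C := 4 / c)
    (f := expSlope α k) fun x hx => by
      rw [Set.uIoc_of_le hab] at hx
      have hx' := h x ⟨hx.1.le, hx.2⟩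
      refine (norm_expSlope_le hk α x).trans ?_
      rw [div_le_div_iff₀ (by positivity) hc]
      nlinarith [mul_le_mul_of_nonneg_left hx' hk]
  rw [abs_of_nonneg (sub_nonneg.2 hab)] at this
  calc _ ≤ _ := this
    _ ≤ 4 / c * 2 := by gcongr
    _ = 8 / c := by ring

/-- The largest interval centred at `α` inside `[-1, 1]` gives a sine integral. The rest stays at
distance at least `a` from `α`, where the slope is bounded independently of `k`. -/
theorem norm_oscIntegral_one_le_of_mem_Ioo {α : ℝ} (hα : α ∈ Set.Ioo (-1 : ℝ) 1) :
    ∃ C : ℝ, 0 ≤ C ∧ ∀ k : ℝ, 0 < k → ‖oscIntegral α k (fun _ => 1)‖ ≤ C / k := by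
  obtain ⟨h1, h2⟩ := hα
  set a : ℝ := min (1 - α) (1 + α) with ha
  have ha0 : 0 < a := lt_min (by linarith) (by linarith)
  have ha1 : a ≤ 1 - α := min_le_left _ _
  have ha2 : a ≤ 1 + α := min_le_right _ _
  refine ⟨2 * |Real.log ((1 - α) ^ 2)| + 2 * |Real.log ((-1 - α) ^ 2)| +
        2 * (8 / a + 6 + 8 / a), by positivity, fun k hk => ?_⟩
  rw [le_div_iff₀ hk, mul_comm]
  refine (norm_mul_oscIntegral_one_le hk.le).trans ?_
  have hi : ∀ a b : ℝ, IntervalIntegrable (expSlope α k) volume a b := fun a b =>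
    (continuous_expSlope α k).intervalIntegrable a b
  rw [← intervalIntegral.integral_add_adjacent_intervals (hi (-1) (α + a)) (hi (α + a) 1),
    ← intervalIntegral.integral_add_adjacent_intervals (hi (-1) (α - a)) (hi (α - a) (α + a))]
  have b1 := norm_integral_expSlope_le_of_far (k := k) (α := α) (a := -1) (b := α - a) ha0
    (by linarith) (by linarith) hk.le fun x hx => by
      rw [abs_sub_comm]; exact le_trans (by linarith [hx.2]) (le_abs_self _)
  have b2 := norm_integral_expSlope_symm_le hk.le ha0.le α
  have b3 := norm_integral_expSlope_le_of_far (k := k) (α := α) (a := α + a) (b := 1) ha0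
    (by linarith) (by linarith) hk.le fun x hx => le_trans (by linarith [hx.1]) (le_abs_self _)
  have := norm_add₃_le (a := ∫ x in (-1 : ℝ)..(α - a), expSlope α k x)
    (b := ∫ x in (α - a)..(α + a), expSlope α k x) (c := ∫ x in (α + a)..1, expSlope α k x)
  linarith

theorem integral_div_one_add_mul {k : ℝ} (hk : 0 ≤ k) :
    ∫ t in (0 : ℝ)..2, 4 * k / (1 + k * t) = 4 * Real.log (1 + 2 * k) := by
  have hne : ∀ t ∈ Set.uIcc (0 : ℝ) 2, 1 + k * t ≠ 0 := fun t ht => by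
    rw [Set.uIcc_of_le (by norm_num)] at ht
    have := mul_nonneg hk ht.1
    positivity
  rw [intervalIntegral.integral_eq_sub_of_hasDerivAt (f := fun t => 4 * Real.log (1 + k * t))]
  · simp [mul_comm]
  · intro t ht
    refine (((((hasDerivAt_id t).const_mul k).const_add 1).log (hne t ht)).const_mul 4).congr_deriv ?_
    simp only [mul_one, id]
    ring
  · exact (continuousOn_const.div (by fun_prop) hne).intervalIntegrable

/-- At an endpoint there is no symmetric partner to cancel against, so the slope is estimated in
absolute value. This is the source of the factor `log k`. -/
theorem norm_oscIntegral_one_le_of_endpoint {α k : ℝ} (hα : α = 1 ∨ α = -1) (hk : 1 ≤ k) :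
    ‖oscIntegral α k (fun _ => 1)‖ ≤ 24 * (1 + Real.log k) / k := by
  have hk0 : 0 ≤ k := by linarith
  have b1 : 2 * |Real.log ((1 - α) ^ 2)| + 2 * |Real.log ((-1 - α) ^ 2)| ≤ 8 := by
    have h4 : |Real.log 4| ≤ 3 := by
      rw [abs_of_nonneg (Real.log_nonneg (by norm_num))]
      linarith [Real.log_le_sub_one_of_pos (show (0 : ℝ) < 4 by norm_num)]
    -- One of the two logarithms is `Real.log 0 = 0`; the other is `log 4`.
    rcases hα with rfl | rfl <;> norm_num <;> linarith
  have b2 : ‖∫ x in (-1 : ℝ)..1, expSlope α k x‖ ≤ 4 * Real.log (1 + 2 * k) := by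
    rw [← integral_div_one_add_mul hk0]
    refine (intervalIntegral.norm_integral_le_integral_norm (by norm_num)).trans ?_
    have e : ∫ t in (0 : ℝ)..2, 4 * k / (1 + k * t) =
        ∫ x in (-1 : ℝ)..1, 4 * k / (1 + k * |x - α|) := by
      rcases hα with rfl | rfl
      · have := intervalIntegral.integral_comp_sub_left (a := -1) (b := 1)
          (fun t => 4 * k / (1 + k * t)) 1
        norm_num at this
        rw [← this]
        refine intervalIntegral.integral_congr fun x hx => ?_
        rw [Set.uIcc_of_le (by norm_num)] at hx
        simp only [abs_sub_comm x, abs_of_nonneg (sub_nonneg.2 hx.2)]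
      · have := intervalIntegral.integral_comp_add_right (a := -1) (b := 1)
          (fun t => 4 * k / (1 + k * t)) 1
        norm_num at this
        rw [← this]
        refine intervalIntegral.integral_congr fun x hx => ?_
        rw [Set.uIcc_of_le (by norm_num)] at hx
        simp only [sub_neg_eq_add, abs_of_nonneg (show 0 ≤ x + 1 by linarith [hx.1])]
    rw [e]
    refine intervalIntegral.integral_mono_on (by norm_num)
      ((continuous_expSlope α k).norm.intervalIntegrable _ _)
      (Continuous.intervalIntegrable ?_ _ _) fun x _ => norm_expSlope_le hk0 α x
    exact continuous_const.div (by fun_prop) fun x => by positivity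
  have b3 : Real.log (1 + 2 * k) ≤ 2 + Real.log k := by
    calc Real.log (1 + 2 * k) ≤ Real.log (3 * k) :=
          Real.log_le_log (by positivity) (by linarith)
      _ = Real.log 3 + Real.log k := Real.log_mul (by norm_num) (by positivity)
      _ ≤ _ := by linarith [Real.log_le_sub_one_of_pos (show (0 : ℝ) < 3 by norm_num)]
  rw [le_div_iff₀ (by positivity), mul_comm]
  linarith [norm_mul_oscIntegral_one_le (α := α) hk0, Real.log_nonneg hk]

/-! ### Orthogonality and the norms of Chebyshev sums. -/

theorem integral_sq_sum_eq {φ : ℕ → ℝ → ℝ} (hφ : ∀ m, Continuous (φ m))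
    (orth : ∀ m n, m ≠ n → ∫ θ in (0 : ℝ)..π, φ m θ * φ n θ = 0) (S : Finset ℕ) (a : ℕ → ℝ) :
    ∫ θ in (0 : ℝ)..π, (∑ m ∈ S, a m * φ m θ) ^ 2 =
      ∑ m ∈ S, a m ^ 2 * ∫ θ in (0 : ℝ)..π, φ m θ ^ 2 := by
  simp only [sq, Finset.sum_mul_sum]
  rw [intervalIntegral.integral_finsetSum fun m _ =>
    Continuous.intervalIntegrable (by fun_prop) _ _]
  refine Finset.sum_congr rfl fun m hm => ?_
  rw [intervalIntegral.integral_finsetSum fun m _ =>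
    Continuous.intervalIntegrable (by fun_prop) _ _]
  have e : ∀ n, ∫ θ in (0 : ℝ)..π, a m * φ m θ * (a n * φ n θ) =
      a m * a n * ∫ θ in (0 : ℝ)..π, φ m θ * φ n θ := fun n => by
    rw [← intervalIntegral.integral_const_mul]
    congr 1; funext θ; ring
  simp only [e]
  rw [Finset.sum_eq_single_of_mem m hm]
  intro n _ hn
  rw [orth m n hn.symm, mul_zero]

theorem integral_norm_sq_sum_le {φ : ℕ → ℝ → ℝ} (hφ : ∀ m, Continuous (φ m))
    (orth : ∀ m n, m ≠ n → ∫ θ in (0 : ℝ)..π, φ m θ * φ n θ = 0)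
    (hb : ∀ m θ, |φ m θ| ≤ 1) (S : Finset ℕ) (d : ℕ → ℂ) :
    ∫ θ in (0 : ℝ)..π, ‖∑ m ∈ S, d m * (φ m θ : ℂ)‖ ^ 2 ≤ π * ∑ m ∈ S, ‖d m‖ ^ 2 := by
  have e : ∀ θ, ‖∑ m ∈ S, d m * (φ m θ : ℂ)‖ ^ 2 =
      (∑ m ∈ S, (d m).re * φ m θ) ^ 2 + (∑ m ∈ S, (d m).im * φ m θ) ^ 2 := fun θ => by
    rw [Complex.sq_norm, Complex.normSq_apply, Complex.re_sum, Complex.im_sum]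
    simp only [Complex.re_mul_ofReal, Complex.im_mul_ofReal]
    ring
  simp only [e]
  rw [intervalIntegral.integral_add (Continuous.intervalIntegrable (by fun_prop) _ _)
    (Continuous.intervalIntegrable (by fun_prop) _ _), integral_sq_sum_eq hφ orth,
    integral_sq_sum_eq hφ orth, ← Finset.sum_add_distrib, Finset.mul_sum]
  refine Finset.sum_le_sum fun m _ => ?_
  have h1 : ∫ θ in (0 : ℝ)..π, φ m θ ^ 2 ≤ π := by
    have := intervalIntegral.integral_mono_on (g := fun _ => 1) Real.pi_pos.le
      (Continuous.intervalIntegrable (u := fun θ => φ m θ ^ 2) (by fun_prop) _ _)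
      (by simp : IntervalIntegrable (fun _ => (1 : ℝ)) volume 0 π)
      (fun θ _ => (sq_le_one_iff_abs_le_one _).2 (hb m θ))
    simpa using this
  have h2 : ‖d m‖ ^ 2 = (d m).re ^ 2 + (d m).im ^ 2 := by
    rw [Complex.sq_norm, Complex.normSq_apply]; ring
  rw [h2, ← add_mul, mul_comm π]
  exact mul_le_mul_of_nonneg_left h1 (by positivity)

theorem integral_cos_int_mul {j : ℤ} (hj : j ≠ 0) :
    ∫ θ in (0 : ℝ)..π, Real.cos (j * θ) = 0 := by
  have hj' : (j : ℝ) ≠ 0 := by exact_mod_cast hj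
  rw [intervalIntegral.integral_comp_mul_left _ hj', integral_cos]
  simp [Real.sin_int_mul_pi]

theorem integral_cos_mul_cos {m n : ℕ} (h : m ≠ n) :
    ∫ θ in (0 : ℝ)..π, Real.cos (m * θ) * Real.cos (n * θ) = 0 := by
  have e : ∀ θ : ℝ, Real.cos (m * θ) * Real.cos (n * θ) = (1 / 2) *
      (Real.cos (((m - n : ℤ) : ℝ) * θ) + Real.cos (((m + n : ℤ) : ℝ) * θ)) := fun θ => by
    push_cast
    rw [sub_mul, add_mul, Real.cos_sub, Real.cos_add]; ring
  simp only [e]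
  rw [intervalIntegral.integral_const_mul, intervalIntegral.integral_add
    (Continuous.intervalIntegrable (by fun_prop) _ _)
    (Continuous.intervalIntegrable (by fun_prop) _ _), integral_cos_int_mul (by omega),
    integral_cos_int_mul (by omega)]
  simp

theorem integral_sin_mul_sin {m n : ℕ} (h : m ≠ n) :
    ∫ θ in (0 : ℝ)..π, Real.sin (m * θ) * Real.sin (n * θ) = 0 := by
  have e : ∀ θ : ℝ, Real.sin (m * θ) * Real.sin (n * θ) = (1 / 2) *
      (Real.cos (((m - n : ℤ) : ℝ) * θ) - Real.cos (((m + n : ℤ) : ℝ) * θ)) := fun θ => by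
    push_cast
    rw [sub_mul, add_mul, Real.cos_sub, Real.cos_add]; ring
  simp only [e]
  rw [intervalIntegral.integral_const_mul, intervalIntegral.integral_sub
    (Continuous.intervalIntegrable (by fun_prop) _ _)
    (Continuous.intervalIntegrable (by fun_prop) _ _), integral_cos_int_mul (by omega),
    integral_cos_int_mul (by omega)]
  simp

/-- The Chebyshev sum `∑ d_m T_m`. -/
noncomputable def chebSum (S : Finset ℕ) (d : ℕ → ℂ) : ℂ[X] :=
  ∑ m ∈ S, Polynomial.C (d m) * Chebyshev.T ℂ m

theorem eval_T_cos (m : ℕ) (θ : ℝ) :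
    (Chebyshev.T ℂ m).eval ((Real.cos θ : ℝ) : ℂ) = (Real.cos (m * θ) : ℂ) := by
  rw [Complex.ofReal_cos, Chebyshev.T_complex_cos]
  push_cast
  rfl

/-- Makes `derivNorm` of a Chebyshev sum the norm of a sine series, to which orthogonality applies.
-/
theorem eval_T_derivative_cos_mul_sin (m : ℕ) (θ : ℝ) :
    (Chebyshev.T ℂ m).derivative.eval ((Real.cos θ : ℝ) : ℂ) * (Real.sin θ : ℂ) =
      m * (Real.sin (m * θ) : ℂ) := by
  rw [Chebyshev.T_derivative_eq_U, Complex.ofReal_cos, Complex.ofReal_sin, Polynomial.eval_mul,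
    mul_assoc, Chebyshev.U_complex_cos]
  push_cast
  rw [sub_add_cancel]
  simp

theorem eval_chebSum_cos (S : Finset ℕ) (d : ℕ → ℂ) (θ : ℝ) :
    (chebSum S d).eval ((Real.cos θ : ℝ) : ℂ) = ∑ m ∈ S, d m * (Real.cos (m * θ) : ℂ) := by
  rw [chebSum, Polynomial.eval_finsetSum]
  simp only [Polynomial.eval_mul, Polynomial.eval_C, eval_T_cos]

theorem valNorm_chebSum_le (S : Finset ℕ) (d : ℕ → ℂ) :
    valNorm (chebSum S d) ≤ √(π * ∑ m ∈ S, ‖d m‖ ^ 2) := by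
  refine Real.sqrt_le_sqrt ?_
  simp only [eval_chebSum_cos]
  exact integral_norm_sq_sum_le (φ := fun m θ => Real.cos (m * θ)) (fun m => by fun_prop)
    (fun m n h => integral_cos_mul_cos h) (fun m θ => Real.abs_cos_le_one _) S d

theorem derivNorm_chebSum_le (S : Finset ℕ) (d : ℕ → ℂ) :
    derivNorm (chebSum S d) ≤ √(π * ∑ m ∈ S, (m * ‖d m‖) ^ 2) := by
  refine Real.sqrt_le_sqrt ?_
  have e : ∀ θ : ℝ, (‖(chebSum S d).derivative.eval ((Real.cos θ : ℝ) : ℂ)‖ * |Real.sin θ|) ^ 2 =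
      ‖∑ m ∈ S, (m * d m) * (Real.sin (m * θ) : ℂ)‖ ^ 2 := fun θ => by
    rw [← Real.norm_eq_abs, ← Complex.norm_real, ← norm_mul, chebSum, Polynomial.derivative_sum,
      Polynomial.eval_finsetSum, Finset.sum_mul]
    congr 2
    refine Finset.sum_congr rfl fun m _ => ?_
    rw [Polynomial.derivative_C_mul, Polynomial.eval_mul, Polynomial.eval_C, mul_assoc,
      eval_T_derivative_cos_mul_sin]
    ring
  simp only [e]
  refine (integral_norm_sq_sum_le (φ := fun m θ => Real.sin (m * θ)) (fun m => by fun_prop)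
    (fun m n h => integral_sin_mul_sin h) (fun m θ => Real.abs_sin_le_one _) S
    (fun m => m * d m)).trans_eq ?_
  simp

theorem derivNorm_T_le (m : ℕ) : derivNorm (Chebyshev.T ℂ m) ≤ 2 * m := by
  have h := derivNorm_chebSum_le {m} (fun _ => 1)
  simp only [chebSum, Finset.sum_singleton, map_one, one_mul, norm_one, mul_one] at h
  refine h.trans (Real.sqrt_le_iff.2 ⟨by positivity, ?_⟩)
  nlinarith [Real.pi_lt_four, sq_nonneg (m : ℝ)]

theorem norm_eval_T_le {x : ℝ} (hx : x ∈ Set.Icc (-1 : ℝ) 1) (m : ℕ) :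
    ‖(Chebyshev.T ℂ m).eval (x : ℂ)‖ ≤ 1 := by
  rw [← Real.cos_arccos hx.1 hx.2, eval_T_cos, Complex.norm_real]
  exact Real.abs_cos_le_one _

/-! ### Aliasing at the Chebyshev nodes. -/

/-- The index `m ≤ N` with `n ≡ ±m` modulo `2N`. -/
def foldIndex (N n : ℕ) : ℕ :=
  if n % (2 * N) ≤ N then n % (2 * N) else 2 * N - n % (2 * N)

theorem foldIndex_spec {N : ℕ} (hN : 1 ≤ N) (n : ℕ) :
    foldIndex N n ≤ N ∧
      ((∃ q, n = q * (2 * N) + foldIndex N n) ∨ ∃ q, n + foldIndex N n = q * (2 * N)) := by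
  have h1 := Nat.mod_lt n (show 0 < 2 * N by omega)
  have h2 := Nat.div_add_mod n (2 * N)
  unfold foldIndex
  split_ifs with h
  · exact ⟨h, Or.inl ⟨n / (2 * N), by rw [mul_comm (n / (2 * N))]; omega⟩⟩
  · refine ⟨by omega, Or.inr ⟨n / (2 * N) + 1, ?_⟩⟩
    rw [add_mul, mul_comm (n / (2 * N))]
    omega

theorem foldIndex_of_le {N n : ℕ} (hN : 1 ≤ N) (hn : n ≤ N) : foldIndex N n = n := by
  unfold foldIndex
  rw [Nat.mod_eq_of_lt (by omega), if_pos hn]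

theorem foldIndex_dvd {N : ℕ} (hN : 1 ≤ N) {a b : ℕ} (h : foldIndex N a = foldIndex N b) :
    (2 * N : ℤ) ∣ (a : ℤ) - b ∨ (2 * N : ℤ) ∣ (a : ℤ) + b := by
  obtain ⟨-, ha⟩ := foldIndex_spec hN a
  obtain ⟨-, hb⟩ := foldIndex_spec hN b
  rw [h] at ha
  rcases ha with ⟨q, ha⟩ | ⟨q, ha⟩ <;> rcases hb with ⟨s, hb⟩ | ⟨s, hb⟩ <;> zify at ha hb
  · exact Or.inl ⟨q - s, by linear_combination ha - hb⟩
  · exact Or.inr ⟨q + s, by linear_combination ha + hb⟩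
  · exact Or.inr ⟨q + s, by linear_combination ha + hb⟩
  · exact Or.inl ⟨q - s, by linear_combination ha - hb⟩

/-- Equal folds mean `a ≡ ±b` modulo `2N`. Inside the block `lN < a, b ≤ (l+1)N` the difference is
too small to be a nonzero multiple, and the only multiple the sum can reach is `2(l+1)N`, which
forces both to be the right end. -/
theorem foldIndex_injOn_block {N : ℕ} (hN : 1 ≤ N) {a b : ℕ} (ha : 1 ≤ a) (hb : 1 ≤ b)
    (h : foldIndex N a = foldIndex N b) (hl : (a - 1) / N = (b - 1) / N) : a = b := by
  have a1 := Nat.div_mul_le_self (a - 1) N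
  have a2 := Nat.lt_div_mul_add (a := a - 1) (b := N) (by omega)
  have b1 := Nat.div_mul_le_self (b - 1) N
  have b2 := Nat.lt_div_mul_add (a := b - 1) (b := N) (by omega)
  rw [← hl] at b1 b2
  generalize (a - 1) / N = l at *
  have a1' : l * N + 1 ≤ a := by omega
  have a2' : a ≤ l * N + N := by omega
  have b1' : l * N + 1 ≤ b := by omega
  have b2' : b ≤ l * N + N := by omega
  rcases foldIndex_dvd hN h with hd | ⟨t, ht⟩
  · have := Int.eq_zero_of_abs_lt_dvd hd (by rw [abs_lt]; constructor <;> omega)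
    omega
  · zify at a1' a2' b1' b2' hN
    have t1 : (l : ℤ) < t := by
      by_contra! hc
      nlinarith
    have t2 : t ≤ l + 1 := by
      by_contra! hc
      have : (l : ℤ) + 2 ≤ t := by omega
      nlinarith
    have : t = l + 1 := by omega
    subst this
    have : (a : ℤ) = b := by nlinarith
    exact_mod_cast this

theorem eval_T_foldIndex_chebNode {N : ℕ} (hN : 1 ≤ N) (n j : ℕ) :
    (Chebyshev.T ℂ (foldIndex N n)).eval (chebNode N j : ℂ) =
      (Chebyshev.T ℂ n).eval (chebNode N j : ℂ) := by
  have hN' : (N : ℝ) ≠ 0 := by positivity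
  rw [chebNode, eval_T_cos, eval_T_cos]
  congr 1
  rcases (foldIndex_spec hN n).2 with ⟨q, hq⟩ | ⟨q, hq⟩
  · have e : (n : ℝ) * (j * π / N) = foldIndex N n * (j * π / N) + (q * j : ℕ) * (2 * π) := by
      have : (n : ℝ) = q * (2 * N) + foldIndex N n := by exact_mod_cast hq
      rw [this]; push_cast; field_simp; ring
    rw [e, Real.cos_add_nat_mul_two_pi]
  · have e : (n : ℝ) * (j * π / N) = (q * j : ℕ) * (2 * π) - foldIndex N n * (j * π / N) := by
      have : (n : ℝ) + foldIndex N n = q * (2 * N) := by exact_mod_cast hq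
      rw [eq_sub_iff_add_eq, ← add_mul, this]; push_cast; field_simp
    rw [e, Real.cos_nat_mul_two_pi_sub]

/-- The interpolation error `∑ c_n (T_n - T_{n'})` of a Chebyshev sum, `n'` the folded index. -/
noncomputable def aliasError (N : ℕ) (S : Finset ℕ) (c : ℕ → ℂ) : ℂ[X] :=
  ∑ n ∈ S, Polynomial.C (c n) * (Chebyshev.T ℂ n - Chebyshev.T ℂ (foldIndex N n))

theorem eval_aliasError (N : ℕ) (S : Finset ℕ) (c : ℕ → ℂ) (z : ℂ) :
    (aliasError N S c).eval z =
      ∑ n ∈ S, c n * ((Chebyshev.T ℂ n).eval z - (Chebyshev.T ℂ (foldIndex N n)).eval z) := by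
  simp [aliasError, Polynomial.eval_finsetSum]

theorem eval_aliasError_chebNode {N : ℕ} (hN : 1 ≤ N) (S : Finset ℕ) (c : ℕ → ℂ) (j : ℕ) :
    (aliasError N S c).eval (chebNode N j : ℂ) = 0 := by
  simp [eval_aliasError, eval_T_foldIndex_chebNode hN]

theorem interpolant_chebSum {N : ℕ} (hN : 1 ≤ N) (S : Finset ℕ) (c : ℕ → ℂ) :
    interpolant N (fun x => (chebSum S c).eval (x : ℂ)) =
      ∑ n ∈ S, Polynomial.C (c n) * Chebyshev.T ℂ (foldIndex N n) := by
  symm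
  rw [interpolant_eq_iff hN]
  constructor
  · refine Polynomial.natDegree_sum_le_of_forall_le _ _ fun n _ => ?_
    refine (Polynomial.natDegree_C_mul_le _ _).trans ?_
    rw [Chebyshev.natDegree_T, Int.natAbs_natCast]
    exact (foldIndex_spec hN n).1
  · intro j _
    simp [chebSum, Polynomial.eval_finsetSum, eval_T_foldIndex_chebNode hN]

theorem sub_interpolant_chebSum {N : ℕ} (hN : 1 ≤ N) (M : ℕ) (c : ℕ → ℂ) :
    chebSum (Finset.range (M + 1)) c -
      interpolant N (fun x => (chebSum (Finset.range (M + 1)) c).eval (x : ℂ)) =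
      aliasError N (Finset.Ioc N M) c := by
  rw [interpolant_chebSum hN, chebSum, ← Finset.sum_sub_distrib, aliasError]
  simp only [← mul_sub]
  symm
  refine Finset.sum_subset (fun n hn => ?_) fun n hn hn' => ?_
  · simp only [Finset.mem_Ioc, Finset.mem_range] at hn ⊢; omega
  · simp only [Finset.mem_Ioc, Finset.mem_range] at hn hn'
    rw [foldIndex_of_le hN (by omega), sub_self, mul_zero]

/-- The coefficients of `aliasError` in the Chebyshev basis. -/
noncomputable def aliasCoeff (N : ℕ) (S : Finset ℕ) (c : ℕ → ℂ) (m : ℕ) : ℂ :=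
  if m ≤ N then -∑ n ∈ S with foldIndex N n = m, c n else c m

/-- As all indices in `S` exceed `N`, they are disjoint from the folded ones: high coefficients
survive unchanged, and each low one collects minus its aliasing class. -/
theorem aliasError_eq_chebSum {N : ℕ} (hN : 1 ≤ N) {S : Finset ℕ} (hS : ∀ n ∈ S, N < n)
    (c : ℕ → ℂ) :
    aliasError N S c = chebSum (Finset.range (N + 1) ∪ S) (aliasCoeff N S c) := by
  have hdis : Disjoint (Finset.range (N + 1)) S := Finset.disjoint_left.2 fun n h1 h2 => by
    have := hS n h2; simp at h1; omega
  rw [chebSum, Finset.sum_union hdis, aliasError]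
  simp only [mul_sub, Finset.sum_sub_distrib]
  have e1 : ∑ m ∈ S, Polynomial.C (aliasCoeff N S c m) * Chebyshev.T ℂ m =
      ∑ m ∈ S, Polynomial.C (c m) * Chebyshev.T ℂ m := Finset.sum_congr rfl fun m hm => by
    rw [aliasCoeff, if_neg (by have := hS m hm; omega)]
  have e2 : ∑ m ∈ Finset.range (N + 1), Polynomial.C (aliasCoeff N S c m) * Chebyshev.T ℂ m =
      -∑ n ∈ S, Polynomial.C (c n) * Chebyshev.T ℂ (foldIndex N n) := by
    rw [← Finset.sum_fiberwise_of_maps_to (s := S) (t := Finset.range (N + 1)) (g := foldIndex N)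
      (fun n _ => by have := (foldIndex_spec hN n).1; simp; omega), ← Finset.sum_neg_distrib]
    refine Finset.sum_congr rfl fun m hm => ?_
    rw [aliasCoeff, if_pos (by simp at hm; omega), map_neg, map_sum, neg_mul, Finset.sum_mul]
    congr 1
    refine Finset.sum_congr rfl fun n hn => ?_
    rw [(Finset.mem_filter.1 hn).2]
  rw [e1, e2]
  ring

/-- The sum `∑ 1 / l²`. -/
noncomputable def basel : ℝ := ∑' l : ℕ, 1 / (l : ℝ) ^ 2

theorem basel_nonneg : 0 ≤ basel := tsum_nonneg fun l => by positivity

/-- Uses `(N/n)^r ≤ N/n ≤ 1/l`, where `l ≥ 1` is the block containing `n`. Lowering the exponent to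
`1` is where `r ≥ 1` enters, and it keeps the constant independent of `r`. -/
theorem rpow_neg_le_of_lt {N n : ℕ} (hN : 1 ≤ N) (hn : N < n) {r : ℝ} (hr : 1 ≤ r) :
    ((n : ℝ) ^ (-r)) ^ 2 ≤ ((N : ℝ) ^ (-r)) ^ 2 * (1 / (((n - 1) / N : ℕ) : ℝ) ^ 2) := by
  have hN0 : (0 : ℝ) < N := by exact_mod_cast hN
  have hn0 : (0 : ℝ) < n := by exact_mod_cast (by omega : 0 < n)
  have hnN : (N : ℝ) ≤ n := by exact_mod_cast hn.le
  set l := (n - 1) / N with hl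
  have hl1 : 1 ≤ l := (Nat.one_le_div_iff (by omega)).2 (by omega)
  have hl0 : (0 : ℝ) < l := by exact_mod_cast hl1
  have hln : (l : ℝ) * N ≤ n := by
    have := Nat.div_mul_le_self (n - 1) N
    rw [← hl] at this
    exact_mod_cast (by omega : l * N ≤ n)
  rw [one_div, ← inv_pow, ← mul_pow]
  refine pow_le_pow_left₀ (by positivity) ?_ 2
  have e : (n : ℝ) ^ (-r) = (N : ℝ) ^ (-r) * ((N : ℝ) / n) ^ r := by
    rw [Real.div_rpow hN0.le hn0.le, Real.rpow_neg hN0.le, Real.rpow_neg hn0.le]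
    have := (Real.rpow_pos_of_pos hN0 r).ne'
    field_simp
  rw [e]
  refine mul_le_mul_of_nonneg_left ?_ (by positivity)
  calc ((N : ℝ) / n) ^ r ≤ ((N : ℝ) / n) ^ (1 : ℝ) :=
        Real.rpow_le_rpow_of_exponent_ge (by positivity) ((div_le_one hn0).2 hnN) hr
    _ = N / n := Real.rpow_one _
    _ ≤ (l : ℝ)⁻¹ := by rw [← one_div, div_le_div_iff₀ hn0 hl0]; linarith

/-- An aliasing class meets each block at most once, so its sum is dominated by `∑ 1/l²`. -/
theorem sum_fiber_rpow_le {N : ℕ} (hN : 1 ≤ N) {S : Finset ℕ} (hS : ∀ n ∈ S, N < n) {r : ℝ}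
    (hr : 1 ≤ r) (m : ℕ) :
    ∑ n ∈ S with foldIndex N n = m, ((n : ℝ) ^ (-r)) ^ 2 ≤ ((N : ℝ) ^ (-r)) ^ 2 * basel := by
  have h1 : ∑ n ∈ S with foldIndex N n = m, ((n : ℝ) ^ (-r)) ^ 2 ≤
      ∑ n ∈ S with foldIndex N n = m,
        ((N : ℝ) ^ (-r)) ^ 2 * (1 / (((n - 1) / N : ℕ) : ℝ) ^ 2) :=
    Finset.sum_le_sum fun n hn => rpow_neg_le_of_lt hN (hS n (Finset.mem_filter.1 hn).1) hr
  refine h1.trans ?_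
  rw [← Finset.mul_sum]
  refine mul_le_mul_of_nonneg_left ?_ (by positivity)
  rw [← Finset.sum_image (f := fun l : ℕ => 1 / (l : ℝ) ^ 2) (g := fun n => (n - 1) / N)]
  · exact (Real.summable_one_div_nat_pow.2 (by norm_num)).sum_le_tsum _
      fun _ _ => by positivity
  · intro a ha b hb hab
    simp only [Finset.coe_filter, Set.mem_ofPred_eq] at ha hb
    have := hS a ha.1
    have := hS b hb.1
    exact foldIndex_injOn_block hN (by omega) (by omega) (ha.2.trans hb.2.symm) hab

/-- Cauchy–Schwarz on each aliasing class, with the weights `n^{-r}` and `n^r`; the classes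
partition `S`. -/
theorem sum_sq_aliasCoeff_low_le {N : ℕ} (hN : 1 ≤ N) {S : Finset ℕ} (hS : ∀ n ∈ S, N < n) {r : ℝ}
    (hr : 1 ≤ r) (c : ℕ → ℂ) :
    ∑ m ∈ Finset.range (N + 1), ‖aliasCoeff N S c m‖ ^ 2 ≤
      ((N : ℝ) ^ (-r)) ^ 2 * basel * ∑ n ∈ S, ((n : ℝ) ^ r * ‖c n‖) ^ 2 := by
  rw [← Finset.sum_fiberwise_of_maps_to (s := S) (t := Finset.range (N + 1)) (g := foldIndex N)
      (fun n _ => by have := (foldIndex_spec hN n).1; simp; omega), Finset.mul_sum]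
  refine Finset.sum_le_sum fun m hm => ?_
  rw [aliasCoeff, if_pos (by simp at hm; omega), norm_neg]
  have h1 : ‖∑ n ∈ S with foldIndex N n = m, c n‖ ≤
      ∑ n ∈ S with foldIndex N n = m, (n : ℝ) ^ (-r) * ((n : ℝ) ^ r * ‖c n‖) := by
    refine (norm_sum_le _ _).trans_eq (Finset.sum_congr rfl fun n hn => ?_)
    have hn0 : (0 : ℝ) < n := by
      have := hS n (Finset.mem_filter.1 hn).1
      exact_mod_cast (by omega : 0 < n)
    rw [← mul_assoc, ← Real.rpow_add hn0]
    simp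
  calc _ ≤ (∑ n ∈ S with foldIndex N n = m, (n : ℝ) ^ (-r) * ((n : ℝ) ^ r * ‖c n‖)) ^ 2 := by
        gcongr
    _ ≤ _ := Finset.sum_mul_sq_le_sq_mul_sq _ _ _
    _ ≤ _ := mul_le_mul_of_nonneg_right (sum_fiber_rpow_le hN hS hr m)
        (Finset.sum_nonneg fun n _ => by positivity)

theorem rpow_one_sub_le {N n : ℕ} (hN : 1 ≤ N) (hn : N < n) {s r : ℝ} (hr : s ≤ r) (x : ℝ)
    (hx : 0 ≤ x) : (n : ℝ) ^ s * x ≤ (N : ℝ) ^ (s - r) * ((n : ℝ) ^ r * x) := by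
  have hN0 : (0 : ℝ) < N := by exact_mod_cast hN
  have hn0 : (0 : ℝ) < n := by exact_mod_cast (by omega : 0 < n)
  have hnN : (N : ℝ) ≤ n := by exact_mod_cast hn.le
  rw [← mul_assoc]
  refine mul_le_mul_of_nonneg_right ?_ hx
  have e : (n : ℝ) ^ s = (n : ℝ) ^ (s - r) * (n : ℝ) ^ r := by
    rw [← Real.rpow_add hn0, sub_add_cancel]
  rw [e]
  exact mul_le_mul_of_nonneg_right
    (Real.rpow_le_rpow_of_nonpos hN0 hnN (by linarith)) (by positivity)

theorem sum_union_aliasCoeff_le {N : ℕ} (hN : 1 ≤ N) {S : Finset ℕ} (hS : ∀ n ∈ S, N < n) {r : ℝ}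
    (hr : 1 ≤ r) (c : ℕ → ℂ) {δ : ℝ} (hδ0 : 0 ≤ δ) (hδ : δ ≤ r) :
    ∑ m ∈ Finset.range (N + 1) ∪ S, ((m : ℝ) ^ δ * ‖aliasCoeff N S c m‖) ^ 2 ≤
      ((N : ℝ) ^ (δ - r)) ^ 2 * (basel + 1) * ∑ n ∈ S, ((n : ℝ) ^ r * ‖c n‖) ^ 2 := by
  have hN0 : (0 : ℝ) < N := by exact_mod_cast hN
  have hdis : Disjoint (Finset.range (N + 1)) S := Finset.disjoint_left.2 fun n h1 h2 => by
    have := hS n h2; simp at h1; omega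
  rw [Finset.sum_union hdis]
  have e1 : ∑ m ∈ Finset.range (N + 1), ((m : ℝ) ^ δ * ‖aliasCoeff N S c m‖) ^ 2 ≤
      ((N : ℝ) ^ δ) ^ 2 * ∑ m ∈ Finset.range (N + 1), ‖aliasCoeff N S c m‖ ^ 2 := by
    rw [Finset.mul_sum]
    refine Finset.sum_le_sum fun m hm => ?_
    rw [← mul_pow]
    have hmN : (m : ℝ) ≤ N := by
      simp only [Finset.mem_range] at hm; exact_mod_cast Nat.le_of_lt_succ hm
    gcongr
  have e2 : ∑ m ∈ S, ((m : ℝ) ^ δ * ‖aliasCoeff N S c m‖) ^ 2 ≤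
      ((N : ℝ) ^ (δ - r)) ^ 2 * ∑ n ∈ S, ((n : ℝ) ^ r * ‖c n‖) ^ 2 := by
    rw [Finset.mul_sum]
    refine Finset.sum_le_sum fun m hm => ?_
    have hm' := hS m hm
    rw [aliasCoeff, if_neg (by omega), ← mul_pow]
    exact pow_le_pow_left₀ (by positivity)
      (rpow_one_sub_le hN hm' hδ _ (norm_nonneg _)) 2
  have e3 := sum_sq_aliasCoeff_low_le hN hS hr c
  have e4 : (N : ℝ) ^ (δ - r) = (N : ℝ) ^ δ * (N : ℝ) ^ (-r) := by
    rw [← Real.rpow_add hN0, sub_eq_add_neg]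
  calc _ ≤ ((N : ℝ) ^ δ) ^ 2 * (((N : ℝ) ^ (-r)) ^ 2 * basel *
        ∑ n ∈ S, ((n : ℝ) ^ r * ‖c n‖) ^ 2) +
      ((N : ℝ) ^ (δ - r)) ^ 2 * ∑ n ∈ S, ((n : ℝ) ^ r * ‖c n‖) ^ 2 :=
        add_le_add (e1.trans (mul_le_mul_of_nonneg_left e3 (by positivity))) e2
    _ = _ := by rw [e4]; ring

/-- The constant in the bounds for the norms of `aliasError`. -/
noncomputable def aliasConst : ℝ := √(π * (basel + 1))

theorem sqrt_sum_union_aliasCoeff_le {N : ℕ} (hN : 1 ≤ N) {S : Finset ℕ} (hS : ∀ n ∈ S, N < n)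
    {r : ℝ} (hr : 1 ≤ r) (c : ℕ → ℂ) {δ : ℝ} (hδ0 : 0 ≤ δ) (hδ : δ ≤ r) :
    √(π * ∑ m ∈ Finset.range (N + 1) ∪ S, ((m : ℝ) ^ δ * ‖aliasCoeff N S c m‖) ^ 2) ≤
      aliasConst * (N : ℝ) ^ (δ - r) * √(∑ n ∈ S, ((n : ℝ) ^ r * ‖c n‖) ^ 2) := by
  have h := sum_union_aliasCoeff_le hN hS hr c hδ0 hδ
  have hb := basel_nonneg
  rw [Real.sqrt_le_iff]
  refine ⟨by unfold aliasConst; positivity, ?_⟩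
  rw [mul_pow, mul_pow, aliasConst, Real.sq_sqrt (by positivity),
    Real.sq_sqrt (Finset.sum_nonneg fun n _ => by positivity)]
  nlinarith [mul_le_mul_of_nonneg_left h Real.pi_pos.le]

theorem valNorm_aliasError_le {N : ℕ} (hN : 1 ≤ N) {S : Finset ℕ} (hS : ∀ n ∈ S, N < n)
    {r : ℝ} (hr : 1 ≤ r) (c : ℕ → ℂ) :
    valNorm (aliasError N S c) ≤
      aliasConst * (N : ℝ) ^ (0 - r) * √(∑ n ∈ S, ((n : ℝ) ^ r * ‖c n‖) ^ 2) := by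
  rw [aliasError_eq_chebSum hN hS]
  refine (valNorm_chebSum_le _ _).trans ?_
  simpa using sqrt_sum_union_aliasCoeff_le hN hS hr c le_rfl (by linarith)

theorem derivNorm_aliasError_le {N : ℕ} (hN : 1 ≤ N) {S : Finset ℕ} (hS : ∀ n ∈ S, N < n)
    {r : ℝ} (hr : 1 ≤ r) (c : ℕ → ℂ) :
    derivNorm (aliasError N S c) ≤
      aliasConst * (N : ℝ) ^ (1 - r) * √(∑ n ∈ S, ((n : ℝ) ^ r * ‖c n‖) ^ 2) := by
  rw [aliasError_eq_chebSum hN hS]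
  refine (derivNorm_chebSum_le _ _).trans ?_
  simpa using sqrt_sum_union_aliasCoeff_le hN hS hr c zero_le_one hr

/-! ### The estimate with `δ ∈ {0, 1}` for the aliasing error. -/

theorem chebNode_zero (N : ℕ) : chebNode N 0 = 1 := by simp [chebNode]

theorem chebNode_self {N : ℕ} (hN : 1 ≤ N) : chebNode N N = -1 := by
  have : (N : ℝ) ≠ 0 := by positivity
  rw [chebNode, mul_div_assoc, mul_div_cancel₀ _ this, Real.cos_pi]

theorem chebNode_half {N : ℕ} (hN : 1 ≤ N) (he : Even N) : chebNode N (N / 2) = 0 := by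
  obtain ⟨m, rfl⟩ := he
  have hm : (m : ℝ) ≠ 0 := by
    have : m ≠ 0 := by omega
    exact_mod_cast this
  have e : (((m + m) / 2 : ℕ) : ℝ) * π / ((m + m : ℕ) : ℝ) = π / 2 := by
    rw [show (m + m) / 2 = m by omega]
    push_cast
    field_simp
    ring
  rw [chebNode, e, Real.cos_pi_div_two]

theorem eval_aliasError_one {N : ℕ} (hN : 1 ≤ N) (S : Finset ℕ) (c : ℕ → ℂ) :
    (aliasError N S c).eval 1 = 0 := by
  simpa [chebNode_zero] using eval_aliasError_chebNode hN S c 0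

theorem eval_aliasError_neg_one {N : ℕ} (hN : 1 ≤ N) (S : Finset ℕ) (c : ℕ → ℂ) :
    (aliasError N S c).eval (-1) = 0 := by
  simpa [chebNode_self hN] using eval_aliasError_chebNode hN S c N

/-- For interior `α`, `p(α) = p(α) - p(1)` is controlled by `derivNorm p` and the bare weight
contributes `O(1/k)`. For `α = ±1`, `p(α) = 0` removes the integral that would bring in a logarithm.
-/
theorem exists_norm_oscIntegral_le_derivNorm {α : ℝ} (hα : α ∈ Set.Icc (-1 : ℝ) 1) :
    ∃ C : ℝ, 0 ≤ C ∧ ∀ (k : ℝ) (p : ℂ[X]), 0 < k → p.eval 1 = 0 → p.eval (-1) = 0 →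
      ‖oscIntegral α k (fun x => p.eval (x : ℂ))‖ ≤ C / k * derivNorm p := by
  obtain ⟨C₁, hC₁, h₁⟩ := norm_oscIntegral_sub_le hα
  by_cases hi : α ∈ Set.Ioo (-1 : ℝ) 1
  · obtain ⟨C₂, hC₂, h₂⟩ := norm_oscIntegral_one_le_of_mem_Ioo hi
    refine ⟨C₁ + 4 * C₂, by positivity, fun k p hk hp _ => ?_⟩
    have b1 : ‖p.eval (α : ℂ)‖ ≤ 4 * derivNorm p := by
      have := norm_eval_sub_le_derivNorm p hα (y := 1) (by norm_num)
      simpa [hp] using this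
    have b2 := mul_le_mul b1 (h₂ k hk) (norm_nonneg _) (by linarith [derivNorm_nonneg p])
    rw [← norm_mul] at b2
    have b3 := norm_le_norm_add_norm_sub' (oscIntegral α k (fun x => p.eval (x : ℂ)))
      (p.eval (α : ℂ) * oscIntegral α k (fun _ => 1))
    calc _ ≤ _ := b3
      _ ≤ 4 * derivNorm p * (C₂ / k) + C₁ / k * derivNorm p := add_le_add b2 (h₁ k p hk)
      _ = _ := by ring
  · refine ⟨C₁, hC₁, fun k p hk hp hp' => ?_⟩
    have h0 : p.eval (α : ℂ) = 0 := by
      have : α = 1 ∨ α = -1 := by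
        rcases eq_or_lt_of_le hα.1 with h | h
        · exact Or.inr h.symm
        rcases eq_or_lt_of_le hα.2 with h' | h'
        · exact Or.inl h'
        exact absurd ⟨h, h'⟩ hi
      rcases this with rfl | rfl <;> simpa
    simpa [h0] using h₁ k p hk

theorem exists_norm_oscIntegral_aliasError_le {α : ℝ} (hα : α ∈ Set.Icc (-1 : ℝ) 1) :
    ∃ C : ℝ, 0 < C ∧ ∀ (δ r k : ℝ) (N : ℕ) (S : Finset ℕ) (c : ℕ → ℂ),
      (δ = 0 ∨ δ = 1) → 1 ≤ r → 0 ≤ k → 1 ≤ N → (∀ n ∈ S, N < n) →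
      ‖oscIntegral α k (fun x => (aliasError N S c).eval (x : ℂ))‖ ≤
        C * (1 + k) ^ (-δ) * (N : ℝ) ^ (δ - r) * √(∑ n ∈ S, ((n : ℝ) ^ r * ‖c n‖) ^ 2) := by
  obtain ⟨C₁, hC₁, h₁⟩ := exists_norm_oscIntegral_le_derivNorm hα
  have hA : 0 ≤ aliasConst := Real.sqrt_nonneg _
  have hL := logNorm_nonneg α
  refine ⟨2 * (aliasConst * logNorm α) + 2 * (C₁ * aliasConst) + 1, by positivity,
    fun δ r k N S c hδ hr hk hN hS => ?_⟩
  have b0 := (norm_oscIntegral_le_valNorm hα k (aliasError N S c)).trans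
    (mul_le_mul_of_nonneg_right (valNorm_aliasError_le hN hS hr c) hL)
  have hN1 : (1 : ℝ) ≤ N := by exact_mod_cast hN
  set B := √(∑ n ∈ S, ((n : ℝ) ^ r * ‖c n‖) ^ 2) with hB
  have hB0 : 0 ≤ B := Real.sqrt_nonneg _
  rcases hδ with rfl | rfl
  · rw [neg_zero, Real.rpow_zero, mul_one, mul_assoc]
    have : 0 ≤ (N : ℝ) ^ (0 - r) * B := by positivity
    calc _ ≤ _ := b0
      _ = (aliasConst * logNorm α) * ((N : ℝ) ^ (0 - r) * B) := by ring
      _ ≤ _ := mul_le_mul_of_nonneg_right (by nlinarith [mul_nonneg hA hL, mul_nonneg hC₁ hA]) this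
  · have hX : 0 ≤ (N : ℝ) ^ (1 - r) * B := by positivity
    have hN' : (N : ℝ) ^ (0 - r) ≤ (N : ℝ) ^ (1 - r) :=
      Real.rpow_le_rpow_of_exponent_le hN1 (by linarith)
    rw [Real.rpow_neg_one, mul_assoc]
    have key : ‖oscIntegral α k (fun x => (aliasError N S c).eval (x : ℂ))‖ ≤
        (2 * (aliasConst * logNorm α) + 2 * (C₁ * aliasConst)) * (1 + k)⁻¹ *
          ((N : ℝ) ^ (1 - r) * B) := by
      -- For `k < 1` the `L²` bound suffices, since `1 ≤ 2/(1+k)` and `N^{-r} ≤ N^{1-r}`; for `k ≥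
      -- 1` integration by parts is used and `1/k ≤ 2/(1+k)`.
      rcases lt_or_ge k 1 with hk1 | hk1
      · have hinv : 1 ≤ 2 * (1 + k)⁻¹ := by
          rw [← div_eq_mul_inv, le_div_iff₀ (by positivity)]; linarith
        calc _ ≤ _ := b0
          _ = (aliasConst * logNorm α) * 1 * ((N : ℝ) ^ (0 - r) * B) := by ring
          _ ≤ (aliasConst * logNorm α + C₁ * aliasConst) * (2 * (1 + k)⁻¹) *
              ((N : ℝ) ^ (1 - r) * B) := by gcongr; nlinarith [mul_nonneg hC₁ hA]
          _ = _ := by ring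
      · have hk0 : 0 < k := by linarith
        have hinv : 1 / k ≤ 2 * (1 + k)⁻¹ := by
          rw [← div_eq_mul_inv, div_le_div_iff₀ hk0 (by positivity)]; linarith
        calc _ ≤ C₁ / k * derivNorm (aliasError N S c) :=
              h₁ k _ hk0 (eval_aliasError_one hN S c) (eval_aliasError_neg_one hN S c)
          _ ≤ C₁ / k * (aliasConst * (N : ℝ) ^ (1 - r) * B) :=
              mul_le_mul_of_nonneg_left (derivNorm_aliasError_le hN hS hr c) (by positivity)
          _ = (0 + C₁ * aliasConst) * (1 / k) * ((N : ℝ) ^ (1 - r) * B) := by ring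
          _ ≤ (aliasConst * logNorm α + C₁ * aliasConst) * (2 * (1 + k)⁻¹) *
              ((N : ℝ) ^ (1 - r) * B) := by gcongr; positivity
          _ = _ := by ring
    refine key.trans (mul_le_mul_of_nonneg_right ?_ hX)
    exact mul_le_mul_of_nonneg_right (by linarith) (by positivity)

/-! ### Second-order decay in `k` when `α` is a node. -/

/-- The logarithmic factor `1 + α² log k`. -/
noncomputable def logFactor (α k : ℝ) : ℝ := 1 + α ^ 2 * Real.log k

theorem one_le_logFactor {k : ℝ} (hk : 1 ≤ k) (α : ℝ) : 1 ≤ logFactor α k := by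
  have := mul_nonneg (sq_nonneg α) (Real.log_nonneg hk)
  unfold logFactor; linarith

theorem exists_norm_oscIntegral_one_le {α : ℝ} (hα : α = 1 ∨ α = -1 ∨ α = 0) :
    ∃ C : ℝ, 0 ≤ C ∧ ∀ k : ℝ, 1 ≤ k → ‖oscIntegral α k (fun _ => 1)‖ ≤ C * logFactor α k / k := by
  rcases hα with h | h | rfl
  · refine ⟨24, by norm_num, fun k hk => ?_⟩
    have := norm_oscIntegral_one_le_of_endpoint (Or.inl h) hk
    subst h
    simpa [logFactor] using this
  · refine ⟨24, by norm_num, fun k hk => ?_⟩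
    have := norm_oscIntegral_one_le_of_endpoint (Or.inr h) hk
    subst h
    simpa [logFactor] using this
  · obtain ⟨C, hC, h⟩ := norm_oscIntegral_one_le_of_mem_Ioo (α := 0) (by norm_num)
    refine ⟨C, hC, fun k hk => ?_⟩
    simpa [logFactor] using h k (by linarith)

theorem exists_norm_oscIntegral_T_le {α : ℝ} (hα : α = 1 ∨ α = -1 ∨ α = 0) :
    ∃ C : ℝ, 0 ≤ C ∧ ∀ (k : ℝ) (j : ℕ), 1 ≤ k →
      ‖oscIntegral α k (fun x => (Chebyshev.T ℂ j).eval (x : ℂ))‖ ≤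
        (j + 1) * (C * logFactor α k / k) := by
  have hα' : α ∈ Set.Icc (-1 : ℝ) 1 := by rcases hα with rfl | rfl | rfl <;> norm_num
  obtain ⟨C₁, hC₁, h₁⟩ := norm_oscIntegral_sub_le hα'
  obtain ⟨C₂, hC₂, h₂⟩ := exists_norm_oscIntegral_one_le hα
  refine ⟨2 * C₁ + C₂, by positivity, fun k j hk => ?_⟩
  have hk0 : 0 < k := by linarith
  have hw := one_le_logFactor hk α
  have b1 := mul_le_mul (norm_eval_T_le hα' j) (h₂ k hk) (norm_nonneg _) zero_le_one
  rw [← norm_mul] at b1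
  have b2 := h₁ k (Chebyshev.T ℂ j) hk0
  have b3 := norm_le_norm_add_norm_sub' (oscIntegral α k
    (fun x => (Chebyshev.T ℂ j).eval (x : ℂ)))
    ((Chebyshev.T ℂ j).eval (α : ℂ) * oscIntegral α k (fun _ => 1))
  calc _ ≤ _ := b3
    _ ≤ 1 * (C₂ * logFactor α k / k) + C₁ / k * (2 * j) :=
        add_le_add b1 (b2.trans (mul_le_mul_of_nonneg_left (derivNorm_T_le j) (by positivity)))
    _ = 1 * (C₂ * logFactor α k / k) + j * (2 * C₁ * 1 / k) := by ring
    _ ≤ (j + 1) * (C₂ * logFactor α k / k) + (j + 1) * (2 * C₁ * logFactor α k / k) := by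
        gcongr
        · exact le_add_of_nonneg_left (Nat.cast_nonneg j)
        · linarith
    _ = _ := by ring

/-- From `U_{j+2} = 2 T_{j+2} + U_j`: summing linear bounds for the `T_j` gives a quadratic one.
With `T_n' = n U_{n-1}` this becomes the cubic growth used for derivatives. -/
theorem norm_oscIntegral_U_le {α k A : ℝ}
    (hT : ∀ j : ℕ, ‖oscIntegral α k (fun x => (Chebyshev.T ℂ j).eval (x : ℂ))‖ ≤ (j + 1) * A)
    (j : ℕ) :
    ‖oscIntegral α k (fun x => (Chebyshev.U ℂ j).eval (x : ℂ))‖ ≤ (j + 1) ^ 2 * A := by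
  have hA : 0 ≤ A := by simpa using (norm_nonneg _).trans (hT 0)
  induction j using Nat.twoStepInduction with
  | zero => simpa using hT 0
  | one =>
    have h := hT 1
    have e : oscIntegral α k (fun x => (Chebyshev.U ℂ ((1 : ℕ) : ℤ)).eval (x : ℂ)) =
        2 * oscIntegral α k (fun x => (Chebyshev.T ℂ ((1 : ℕ) : ℤ)).eval (x : ℂ)) := by
      rw [← oscIntegral_const_mul]; simp
    rw [e, norm_mul, Complex.norm_two]
    norm_num at h ⊢
    linarith
  | more j ih _ =>
    have e : oscIntegral α k (fun x => (Chebyshev.U ℂ ((j + 2 : ℕ) : ℤ)).eval (x : ℂ)) =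
        2 * oscIntegral α k (fun x => (Chebyshev.T ℂ ((j + 2 : ℕ) : ℤ)).eval (x : ℂ)) +
          oscIntegral α k (fun x => (Chebyshev.U ℂ (j : ℤ)).eval (x : ℂ)) := by
      rw [← oscIntegral_const_mul, ← oscIntegral_add (by fun_prop) (by fun_prop)]
      push_cast
      rw [Chebyshev.U_eq_two_mul_T_add_U]
      simp
    have h := hT (j + 2)
    have hn := norm_add_le (2 * oscIntegral α k
      (fun x => (Chebyshev.T ℂ ((j + 2 : ℕ) : ℤ)).eval (x : ℂ)))
      (oscIntegral α k (fun x => (Chebyshev.U ℂ (j : ℤ)).eval (x : ℂ)))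
    rw [norm_mul, Complex.norm_two, ← e] at hn
    push_cast at h hn ⊢
    nlinarith [mul_nonneg (Nat.cast_nonneg (α := ℝ) j) hA]

theorem norm_oscIntegral_derivative_T_le {α k A : ℝ}
    (hT : ∀ j : ℕ, ‖oscIntegral α k (fun x => (Chebyshev.T ℂ j).eval (x : ℂ))‖ ≤ (j + 1) * A)
    (n : ℕ) :
    ‖oscIntegral α k (fun x => (Chebyshev.T ℂ n).derivative.eval (x : ℂ))‖ ≤ n ^ 3 * A := by
  rcases n with _ | m
  · simp [oscIntegral]
  · have e : oscIntegral α k (fun x => (Chebyshev.T ℂ ((m + 1 : ℕ) : ℤ)).derivative.eval (x : ℂ)) =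
        ((m + 1 : ℕ) : ℂ) * oscIntegral α k (fun x => (Chebyshev.U ℂ (m : ℤ)).eval (x : ℂ)) := by
      rw [← oscIntegral_const_mul, Chebyshev.T_derivative_eq_U]
      simp
    rw [e, norm_mul, Complex.norm_natCast]
    have := mul_le_mul_of_nonneg_left (norm_oscIntegral_U_le hT m) (Nat.cast_nonneg (α := ℝ) (m + 1))
    refine this.trans_eq ?_
    push_cast
    ring

/-- The oscillatory integral `∫ p(x) exp(ikx) dx` without singular weight. -/
noncomputable def fourierIntegral (k : ℝ) (p : ℂ[X]) : ℂ :=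
  ∫ x in (-1 : ℝ)..1, p.eval (x : ℂ) * Complex.exp (Complex.I * k * x)

theorem fourierIntegral_add (k : ℝ) (p q : ℂ[X]) :
    fourierIntegral k (p + q) = fourierIntegral k p + fourierIntegral k q := by
  rw [fourierIntegral, fourierIntegral, fourierIntegral, ← intervalIntegral.integral_add
    (Continuous.intervalIntegrable (by fun_prop) _ _)
    (Continuous.intervalIntegrable (by fun_prop) _ _)]
  simp only [Polynomial.eval_add, add_mul]

theorem fourierIntegral_C_mul (k : ℝ) (c : ℂ) (p : ℂ[X]) :
    fourierIntegral k (Polynomial.C c * p) = c * fourierIntegral k p := by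
  rw [fourierIntegral, fourierIntegral, ← intervalIntegral.integral_const_mul]
  simp only [Polynomial.eval_mul, Polynomial.eval_C, mul_assoc]

theorem fourierIntegral_sub (k : ℝ) (p q : ℂ[X]) :
    fourierIntegral k (p - q) = fourierIntegral k p - fourierIntegral k q := by
  have h := fourierIntegral_C_mul k (-1) q
  rw [map_neg, map_one, neg_one_mul, neg_one_mul] at h
  rw [sub_eq_add_neg, fourierIntegral_add, h, sub_eq_add_neg]

theorem norm_fourierIntegral_T_le {k : ℝ} (hk : 0 < k) (j : ℕ) :
    ‖fourierIntegral k (Chebyshev.T ℂ j)‖ ≤ (j + 1) * (4 / k) := by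
  set p := Chebyshev.T ℂ (j : ℤ) with hp
  have ftc := intervalIntegral.integral_eq_sub_of_hasDerivAt (a := -1) (b := 1)
    (fun x _ => (hasDerivAt_eval_ofReal p x).mul (hasDerivAt_cexp k x))
    (Continuous.intervalIntegrable (by fun_prop) _ _)
  rw [intervalIntegral.integral_add (Continuous.intervalIntegrable (by fun_prop) _ _)
    (Continuous.intervalIntegrable (by fun_prop) _ _)] at ftc
  have e : Complex.I * k * fourierIntegral k p =
      p.eval ((1 : ℝ) : ℂ) * Complex.exp (Complex.I * k * (1 : ℝ)) -
        p.eval ((-1 : ℝ) : ℂ) * Complex.exp (Complex.I * k * (-1 : ℝ)) -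
      ∫ x in (-1 : ℝ)..1, p.derivative.eval (x : ℂ) * Complex.exp (Complex.I * k * x) := by
    rw [fourierIntegral, ← intervalIntegral.integral_const_mul, eq_sub_iff_add_eq']
    simp only [Pi.mul_apply] at ftc
    rw [← ftc]
    congr 2
    funext x
    ring
  have b1 := norm_eval_T_le (x := 1) (by norm_num) j
  have b2 := norm_eval_T_le (x := -1) (by norm_num) j
  have b3 := (norm_integral_mul_cexp_le (a := -1) (b := 1) (by norm_num) k
    (fun x : ℝ => p.derivative.eval (x : ℂ))).trans (integral_norm_derivative_le p)
  have b4 : derivNorm p * √π ≤ 2 * j * 2 :=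
    mul_le_mul (derivNorm_T_le j) (Real.sqrt_le_iff.2 ⟨by norm_num, by linarith [Real.pi_lt_four]⟩)
      (Real.sqrt_nonneg _) (by positivity)
  have n := congrArg norm e
  rw [norm_mul, norm_mul, Complex.norm_I, Complex.norm_real, Real.norm_of_nonneg hk.le,
    one_mul] at n
  rw [mul_div_assoc', le_div_iff₀ hk, mul_comm, n]
  refine (norm_sub_le _ _).trans ((add_le_add_left (norm_sub_le _ _) _).trans ?_)
  rw [norm_mul, norm_mul, norm_cexp_I_mul_mul, norm_cexp_I_mul_mul]
  linarith

/-- The divided difference `(T_n(x) - T_n(α)) / (x - α)`. -/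
noncomputable def chebDiff (α : ℝ) : ℕ → ℂ[X]
  | 0 => 0
  | 1 => 1
  | n + 2 => Polynomial.C (2 * (α : ℂ)) * chebDiff α (n + 1) - chebDiff α n +
      Polynomial.C 2 * Chebyshev.T ℂ ((n + 1 : ℕ) : ℤ)

/-- The recursion for `chebDiff` is the three-term recurrence of `T` at `x` minus that at `α`, with
`2x T_{n+1}(x)` split as `2(x - α) T_{n+1}(x) + 2α T_{n+1}(x)`. -/
theorem sub_mul_eval_chebDiff (α x : ℝ) (n : ℕ) :
    (Chebyshev.T ℂ n).eval (x : ℂ) - (Chebyshev.T ℂ n).eval (α : ℂ) =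
      (x - α) * (chebDiff α n).eval (x : ℂ) := by
  induction n using Nat.twoStepInduction with
  | zero => simp [chebDiff]
  | one => simp [chebDiff]
  | more n ih1 ih2 =>
    rw [chebDiff]
    push_cast at ih1 ih2 ⊢
    rw [Chebyshev.T_add_two]
    simp only [Polynomial.eval_add, Polynomial.eval_sub, Polynomial.eval_mul, Polynomial.eval_C,
      Polynomial.eval_X, Polynomial.eval_ofNat]
    linear_combination 2 * (α : ℂ) * ih2 - ih1

/-- The integrals inherit the recurrence of `chebDiff`, forced by the `O((j+1)/k)` integrals of
`T_j`. For these three `α` it can be solved by hand without exponential growth. -/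
theorem norm_fourierIntegral_chebDiff_le {α k : ℝ} (hα : α = 1 ∨ α = -1 ∨ α = 0) (hk : 0 < k)
    (n : ℕ) : ‖fourierIntegral k (chebDiff α n)‖ ≤ n ^ 3 * (8 / k) := by
  have hA : 0 ≤ 4 / k := by positivity
  have e8 : 8 / k = 2 * (4 / k) := by ring
  have hT := norm_fourierIntegral_T_le hk
  rw [e8]
  set A := 4 / k
  set b : ℕ → ℂ := fun n => fourierIntegral k (chebDiff α n) with hb
  have b0 : b 0 = 0 := by simp [hb, chebDiff, fourierIntegral]
  have b1 : ‖b 1‖ ≤ A := by simpa [hb, chebDiff] using hT 0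
  have hrec : ∀ n, b (n + 2) = 2 * α * b (n + 1) - b n +
      2 * fourierIntegral k (Chebyshev.T ℂ ((n + 1 : ℕ) : ℤ)) := fun n => by
    simp only [hb, chebDiff, fourierIntegral_add, fourierIntegral_sub, fourierIntegral_C_mul]
  change ‖b n‖ ≤ _
  by_cases h0 : α = 0
  · induction n using Nat.twoStepInduction with
    | zero => simp [b0]
    | one => norm_num; linarith
    | more n ih _ =>
      have h := norm_sub_le (2 * fourierIntegral k (Chebyshev.T ℂ ((n + 1 : ℕ) : ℤ))) (b n)
      have e : b (n + 2) = 2 * fourierIntegral k (Chebyshev.T ℂ ((n + 1 : ℕ) : ℤ)) - b n := by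
        rw [hrec, h0]; push_cast; ring
      rw [← e, norm_mul, Complex.norm_two] at h
      have h2 := hT (n + 1)
      push_cast at h h2 ⊢
      have : 0 ≤ (n : ℝ) * A := by positivity
      have : 0 ≤ (n : ℝ) ^ 2 * A := by positivity
      nlinarith
  -- With `α² = 1` the characteristic polynomial is `(z - α)²`, so the recurrence factors into two
  -- first-order ones. The differences `b (n+1) - α b n` grow quadratically, and summing them again
  -- gives the cube.
  · have hs : (α : ℂ) * α = 1 := by rcases hα with rfl | rfl | h <;> simp_all
    have hs1 : ‖(α : ℂ)‖ = 1 := by rcases hα with rfl | rfl | h <;> simp_all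
    have hd : ∀ n, ‖b (n + 1) - α * b n‖ ≤ (n + 1) ^ 2 * (2 * A) := fun n => by
      induction n with
      | zero => simp [b0]; linarith
      | succ n ih =>
        have e : b (n + 2) - α * b (n + 1) = α * (b (n + 1) - α * b n) +
            2 * fourierIntegral k (Chebyshev.T ℂ ((n + 1 : ℕ) : ℤ)) := by
          rw [hrec]; linear_combination b n * hs
        have h := norm_add_le (α * (b (n + 1) - α * b n))
          (2 * fourierIntegral k (Chebyshev.T ℂ ((n + 1 : ℕ) : ℤ)))
        rw [← e, norm_mul, norm_mul, Complex.norm_two, hs1] at h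
        have h2 := hT (n + 1)
        push_cast at h h2 ⊢
        have : 0 ≤ (n : ℝ) * A := by positivity
        nlinarith
    induction n with
    | zero => simp [b0]
    | succ n ih =>
      have h := norm_add_le (b (n + 1) - α * b n) (α * b n)
      rw [sub_add_cancel, norm_mul, hs1] at h
      have h2 := hd n
      push_cast
      have : 0 ≤ (n : ℝ) * A := by positivity
      have : 0 ≤ (n : ℝ) ^ 2 * A := by positivity
      nlinarith

/-- Agreement at `±1` kills the boundary terms, and agreement at `α` makes the integration by parts
legitimate. It gives one factor `1/k`; the remaining integrals supply the second. -/
theorem exists_norm_oscIntegral_T_sub_T_le {α : ℝ} (hα : α = 1 ∨ α = -1 ∨ α = 0) :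
    ∃ C : ℝ, 0 ≤ C ∧ ∀ (k : ℝ) (a n : ℕ), 1 ≤ k → a ≤ n →
      (Chebyshev.T ℂ n).eval 1 = (Chebyshev.T ℂ a).eval 1 →
      (Chebyshev.T ℂ n).eval (-1) = (Chebyshev.T ℂ a).eval (-1) →
      (Chebyshev.T ℂ n).eval (α : ℂ) = (Chebyshev.T ℂ a).eval (α : ℂ) →
      ‖oscIntegral α k (fun x => (Chebyshev.T ℂ n - Chebyshev.T ℂ a).eval (x : ℂ))‖ ≤
        C * logFactor α k * n ^ 3 / k ^ 2 := by
  obtain ⟨C, hC, hT⟩ := exists_norm_oscIntegral_T_le hα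
  refine ⟨2 * C + 32, by positivity, fun k a n hk han h1 h2 h3 => ?_⟩
  have hk0 : 0 < k := by linarith
  have hw := one_le_logFactor hk α
  have han' : (a : ℝ) ^ 3 ≤ n ^ 3 := by gcongr
  have key := integral_by_parts_log k (α := α) (q := Chebyshev.T ℂ n - Chebyshev.T ℂ a)
    (h := chebDiff α n - chebDiff α a) (fun x => by
      simp only [Polynomial.eval_sub]
      linear_combination sub_mul_eval_chebDiff α x n - sub_mul_eval_chebDiff α x a + h3)
  rw [Polynomial.eval_sub, Polynomial.eval_sub, h1, h2, sub_self, sub_self, zero_mul, zero_mul,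
    zero_mul, zero_mul, sub_zero, zero_sub] at key
  change _ = -(_ + 2 * fourierIntegral k (chebDiff α n - chebDiff α a)) at key
  simp only [Polynomial.derivative_sub] at key
  rw [fourierIntegral_sub] at key
  have e : oscIntegral α k
      (fun x => ((Chebyshev.T ℂ n).derivative - (Chebyshev.T ℂ a).derivative).eval (x : ℂ)) =
      oscIntegral α k (fun x => (Chebyshev.T ℂ n).derivative.eval (x : ℂ)) -
      oscIntegral α k (fun x => (Chebyshev.T ℂ a).derivative.eval (x : ℂ)) := by
    simp only [Polynomial.eval_sub]
    exact oscIntegral_sub (by fun_prop) (by fun_prop) α k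
  rw [e] at key
  have d1 := norm_oscIntegral_derivative_T_le (fun j => hT k j hk) n
  have d2 := norm_oscIntegral_derivative_T_le (fun j => hT k j hk) a
  have d3 := norm_fourierIntegral_chebDiff_le hα hk0 n
  have d4 := norm_fourierIntegral_chebDiff_le hα hk0 a
  have nn := congrArg norm key
  rw [norm_mul, norm_mul, Complex.norm_I, Complex.norm_real, Real.norm_of_nonneg hk0.le,
    one_mul, norm_neg] at nn
  have d5 := norm_add_le (oscIntegral α k (fun x => (Chebyshev.T ℂ n).derivative.eval (x : ℂ)) -
      oscIntegral α k (fun x => (Chebyshev.T ℂ a).derivative.eval (x : ℂ)))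
      (2 * (fourierIntegral k (chebDiff α n) - fourierIntegral k (chebDiff α a)))
  rw [← nn, norm_mul, Complex.norm_two] at d5
  have d6 := norm_sub_le (oscIntegral α k (fun x => (Chebyshev.T ℂ n).derivative.eval (x : ℂ)))
      (oscIntegral α k (fun x => (Chebyshev.T ℂ a).derivative.eval (x : ℂ)))
  have d7 := norm_sub_le (fourierIntegral k (chebDiff α n)) (fourierIntegral k (chebDiff α a))
  have x1 : (a : ℝ) ^ 3 * (C * logFactor α k / k) ≤ n ^ 3 * (C * logFactor α k / k) := by gcongr
  have x2 : (a : ℝ) ^ 3 * (8 / k) ≤ n ^ 3 * (8 / k) := by gcongr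
  have x3 : (n : ℝ) ^ 3 * (8 / k) ≤ n ^ 3 * (8 / k) * logFactor α k :=
    le_mul_of_one_le_right (by positivity) hw
  rw [le_div_iff₀ (by positivity)]
  set y := ‖oscIntegral α k (fun x => (Chebyshev.T ℂ n - Chebyshev.T ℂ a).eval (x : ℂ))‖
  have z : k * y ≤ (2 * C + 32) * logFactor α k * n ^ 3 / k := by
    calc k * y ≤ 2 * (n ^ 3 * (C * logFactor α k / k)) + 4 * (n ^ 3 * (8 / k) * logFactor α k) := by
          linarith
      _ = _ := by ring
  rw [le_div_iff₀ hk0] at z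
  linarith

theorem norm_oscIntegral_T_le_logNorm {α : ℝ} (hα : α ∈ Set.Icc (-1 : ℝ) 1) (k : ℝ) (j : ℕ) :
    ‖oscIntegral α k (fun x => (Chebyshev.T ℂ j).eval (x : ℂ))‖ ≤ 2 * logNorm α := by
  refine (norm_oscIntegral_le_valNorm hα k _).trans
    (mul_le_mul_of_nonneg_right ?_ (logNorm_nonneg α))
  have h := valNorm_chebSum_le {j} (fun _ => 1)
  simp only [chebSum, Finset.sum_singleton, map_one, one_mul, norm_one, mul_one, one_pow] at h
  exact h.trans (Real.sqrt_le_iff.2 ⟨by norm_num, by linarith [Real.pi_lt_four]⟩)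

theorem exists_norm_oscIntegral_T_sub_foldIndex_le :
    ∃ C : ℝ, 0 ≤ C ∧ ∀ (α k : ℝ) (N n : ℕ),
      (((α = 1 ∨ α = -1) ∧ 1 ≤ k) ∨ (α = 0 ∧ Even N ∧ 0 ≤ k)) → 1 ≤ N → N < n →
      ‖oscIntegral α k (fun x => (Chebyshev.T ℂ n - Chebyshev.T ℂ (foldIndex N n)).eval (x : ℂ))‖ ≤
        C * (1 + k) ^ (-2 : ℝ) * (1 + α ^ 2 * Real.log k) * n ^ 3 := by
  obtain ⟨C₁, hC₁, h₁⟩ := exists_norm_oscIntegral_T_sub_T_le (α := 1) (by norm_num)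
  obtain ⟨C₂, hC₂, h₂⟩ := exists_norm_oscIntegral_T_sub_T_le (α := -1) (by norm_num)
  obtain ⟨C₃, hC₃, h₃⟩ := exists_norm_oscIntegral_T_sub_T_le (α := 0) (by norm_num)
  have hL := logNorm_nonneg 0
  refine ⟨4 * (C₁ + C₂ + C₃) + 16 * logNorm 0, by positivity, fun α k N n hα hN hn => ?_⟩
  have hk : 0 ≤ k := by rcases hα with h | h <;> linarith [h.2]
  have hfn : foldIndex N n ≤ n := (foldIndex_spec hN n).1.trans hn.le
  have hn1 : (1 : ℝ) ≤ n ^ 3 := one_le_pow₀ (by exact_mod_cast (by omega : 1 ≤ n))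
  have v1 := (eval_T_foldIndex_chebNode hN n 0).symm
  have v2 := (eval_T_foldIndex_chebNode hN n N).symm
  rw [chebNode_zero, Complex.ofReal_one] at v1
  rw [chebNode_self hN, Complex.ofReal_neg, Complex.ofReal_one] at v2
  have e2 : (1 + k) ^ (-2 : ℝ) = 1 / (1 + k) ^ 2 := by
    rw [Real.rpow_neg (by positivity), one_div]; norm_num
  rw [e2]
  have large : ∀ C : ℝ, 0 ≤ C → C ≤ C₁ + C₂ + C₃ → 1 ≤ k → ∀ y : ℝ,
      y ≤ C * logFactor α k * n ^ 3 / k ^ 2 →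
      y ≤ (4 * (C₁ + C₂ + C₃) + 16 * logNorm 0) * (1 / (1 + k) ^ 2) *
        (1 + α ^ 2 * Real.log k) * n ^ 3 := by
    intro C hC0 hC hk1 y hy
    have hw := one_le_logFactor hk1 α
    have hinv : 1 / k ^ 2 ≤ 4 * (1 / (1 + k) ^ 2) := by
      rw [mul_one_div, div_le_div_iff₀ (by positivity) (by positivity)]; nlinarith
    change _ ≤ _ * logFactor α k * n ^ 3
    calc y ≤ C * (1 / k ^ 2) * logFactor α k * n ^ 3 := by
          refine hy.trans_eq ?_; ring
      _ ≤ (C₁ + C₂ + C₃ + 4 * logNorm 0) * (4 * (1 / (1 + k) ^ 2)) * logFactor α k * n ^ 3 := by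
          gcongr; linarith
      _ = _ := by ring
  rcases hα with ⟨rfl | rfl, hk1⟩ | ⟨rfl, he, -⟩
  · exact large C₁ hC₁ (by linarith) hk1 _ (h₁ k _ n hk1 hfn v1 v2 (by simp))
  · exact large C₂ hC₂ (by linarith) hk1 _ (h₂ k _ n hk1 hfn v1 v2 (by simpa using v2))
  · rcases le_or_gt 1 k with hk1 | hk1
    · have v3 := (eval_T_foldIndex_chebNode hN n (N / 2)).symm
      rw [chebNode_half hN he] at v3
      exact large C₃ hC₃ (by linarith) hk1 _ (h₃ k _ n hk1 hfn v1 v2 v3)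
    -- For `α = 0` and `k < 1` no decay is needed: the crude bound is enough because `(1+k)² ≤ 4`.
    -- The logarithmic factor equals `1` as its coefficient `α²` is zero, even at `k = 0`.
    · simp only [Polynomial.eval_sub]
      rw [oscIntegral_sub (by fun_prop) (by fun_prop)]
      have b1 := norm_oscIntegral_T_le_logNorm (α := 0) (by norm_num) k n
      have b2 := norm_oscIntegral_T_le_logNorm (α := 0) (by norm_num) k (foldIndex N n)
      have hinv : 1 ≤ 4 * (1 / (1 + k) ^ 2) := by
        rw [mul_one_div, le_div_iff₀ (by positivity)]; nlinarith
      have b3 := norm_sub_le (oscIntegral 0 k (fun x => (Chebyshev.T ℂ n).eval (x : ℂ)))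
        (oscIntegral 0 k (fun x => (Chebyshev.T ℂ (foldIndex N n)).eval (x : ℂ)))
      calc _ ≤ 4 * logNorm 0 * 1 * 1 := by linarith
        _ ≤ (C₁ + C₂ + C₃ + 4 * logNorm 0) * (4 * (1 / (1 + k) ^ 2)) * n ^ 3 := by
            gcongr; linarith
        _ = _ := by ring

/-- Cauchy–Schwarz with `n³ = n^{3-r} n^r`. The square of `n^{3-r}` is `n^{-1-2ε}`, which is
summable, times the square of `n^{7/2+ε-r}`, which is at most its value at `N`. -/
theorem sum_norm_mul_cube_le {ε r : ℝ} (hε : 0 < ε) (hr : 7 / 2 + ε < r) {N : ℕ} (hN : 1 ≤ N)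
    {S : Finset ℕ} (hS : ∀ n ∈ S, N < n) (c : ℕ → ℂ) :
    ∑ n ∈ S, ‖c n‖ * n ^ 3 ≤ √(∑' n : ℕ, (n : ℝ) ^ (-(1 + 2 * ε))) * (N : ℝ) ^ (7 / 2 + ε - r) *
      √(∑ n ∈ S, ((n : ℝ) ^ r * ‖c n‖) ^ 2) := by
  have hN0 : (0 : ℝ) < N := by exact_mod_cast hN
  have h1 : ∑ n ∈ S, ‖c n‖ * (n : ℝ) ^ 3 =
      ∑ n ∈ S, (n : ℝ) ^ (3 - r) * ((n : ℝ) ^ r * ‖c n‖) := Finset.sum_congr rfl fun n hn => by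
    have hn0 : (0 : ℝ) < n := by exact_mod_cast (by have := hS n hn; omega : 0 < n)
    rw [← mul_assoc, ← Real.rpow_add hn0, sub_add_cancel, mul_comm]
    norm_num
  have h2 : ∑ n ∈ S, ((n : ℝ) ^ (3 - r)) ^ 2 ≤
      (∑' n : ℕ, (n : ℝ) ^ (-(1 + 2 * ε))) * ((N : ℝ) ^ (7 / 2 + ε - r)) ^ 2 := by
    have hs : Summable fun n : ℕ => (n : ℝ) ^ (-(1 + 2 * ε)) :=
      Real.summable_nat_rpow.2 (by linarith)
    refine le_trans ?_ (mul_le_mul_of_nonneg_right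
      (hs.sum_le_tsum S fun n _ => by positivity) (by positivity))
    rw [Finset.sum_mul]
    refine Finset.sum_le_sum fun n hn => ?_
    have hn' := hS n hn
    have hn0 : (0 : ℝ) < n := by exact_mod_cast (by omega : 0 < n)
    have hnN : (N : ℝ) ≤ n := by exact_mod_cast hn'.le
    calc ((n : ℝ) ^ (3 - r)) ^ 2 = (n : ℝ) ^ (-(1 + 2 * ε)) * ((n : ℝ) ^ (7 / 2 + ε - r)) ^ 2 := by
          rw [← Real.rpow_natCast, ← Real.rpow_natCast, ← Real.rpow_mul hn0.le,
            ← Real.rpow_mul hn0.le, ← Real.rpow_add hn0]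
          congr 1
          push_cast
          ring
      _ ≤ _ := by
          refine mul_le_mul_of_nonneg_left (pow_le_pow_left₀ (by positivity) ?_ 2) (by positivity)
          exact Real.rpow_le_rpow_of_nonpos hN0 hnN (by linarith)
  rw [h1]
  refine (Real.sum_mul_le_sqrt_mul_sqrt _ _ _).trans
    (mul_le_mul_of_nonneg_right ?_ (Real.sqrt_nonneg _))
  refine (Real.sqrt_le_sqrt h2).trans_eq ?_
  rw [Real.sqrt_mul (tsum_nonneg fun n => by positivity), Real.sqrt_sq (by positivity)]

theorem oscIntegral_aliasError (α k : ℝ) (N : ℕ) (S : Finset ℕ) (c : ℕ → ℂ) :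
    oscIntegral α k (fun x => (aliasError N S c).eval (x : ℂ)) =
      ∑ n ∈ S, c n * oscIntegral α k
        (fun x => (Chebyshev.T ℂ n - Chebyshev.T ℂ (foldIndex N n)).eval (x : ℂ)) := by
  induction S using Finset.induction_on with
  | empty => simp [aliasError, oscIntegral]
  | insert n S hn ih =>
    rw [Finset.sum_insert hn, ← ih, ← oscIntegral_const_mul,
      ← oscIntegral_add (by fun_prop) (by fun_prop)]
    simp [aliasError, Finset.sum_insert hn]

theorem exists_norm_oscIntegral_aliasError_le_sq {ε : ℝ} (hε : 0 < ε) :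
    ∃ C : ℝ, 0 < C ∧ ∀ (α r k : ℝ) (N : ℕ) (S : Finset ℕ) (c : ℕ → ℂ),
      (((α = 1 ∨ α = -1) ∧ 1 ≤ k) ∨ (α = 0 ∧ Even N ∧ 0 ≤ k)) →
      7 / 2 + ε < r → 1 ≤ N → (∀ n ∈ S, N < n) →
      ‖oscIntegral α k (fun x => (aliasError N S c).eval (x : ℂ))‖ ≤
        C * (1 + k) ^ (-2 : ℝ) * (1 + α ^ 2 * Real.log k) * (N : ℝ) ^ (7 / 2 + ε - r) *
          √(∑ n ∈ S, ((n : ℝ) ^ r * ‖c n‖) ^ 2) := by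
  obtain ⟨C, hC, h⟩ := exists_norm_oscIntegral_T_sub_foldIndex_le
  set Z := √(∑' n : ℕ, (n : ℝ) ^ (-(1 + 2 * ε)))
  have hZ : 0 ≤ Z := Real.sqrt_nonneg _
  refine ⟨C * Z + 1, by positivity, fun α r k N S c hα hr hN hS => ?_⟩
  have hk : 0 ≤ k := by rcases hα with h | h <;> linarith [h.2]
  have hw : 0 ≤ 1 + α ^ 2 * Real.log k := by
    rcases hα with ⟨-, h1⟩ | ⟨rfl, -⟩
    · have := Real.log_nonneg h1
      positivity
    · norm_num
  rw [oscIntegral_aliasError]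
  have hs := sum_norm_mul_cube_le hε hr hN hS c
  set B := √(∑ n ∈ S, ((n : ℝ) ^ r * ‖c n‖) ^ 2)
  have hB : 0 ≤ B := Real.sqrt_nonneg _
  calc _ ≤ ∑ n ∈ S, ‖c n‖ * (C * (1 + k) ^ (-2 : ℝ) * (1 + α ^ 2 * Real.log k) * n ^ 3) := by
        refine (norm_sum_le _ _).trans (Finset.sum_le_sum fun n hn => ?_)
        rw [norm_mul]
        exact mul_le_mul_of_nonneg_left (h α k N n hα hN (hS n hn)) (norm_nonneg _)
    _ = C * (1 + k) ^ (-2 : ℝ) * (1 + α ^ 2 * Real.log k) * ∑ n ∈ S, ‖c n‖ * n ^ 3 := by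
        rw [Finset.mul_sum]
        exact Finset.sum_congr rfl fun n _ => by ring
    _ ≤ C * (1 + k) ^ (-2 : ℝ) * (1 + α ^ 2 * Real.log k) *
          (Z * (N : ℝ) ^ (7 / 2 + ε - r) * B) := mul_le_mul_of_nonneg_left hs (by positivity)
    _ = C * Z * ((1 + k) ^ (-2 : ℝ) * (1 + α ^ 2 * Real.log k) *
          (N : ℝ) ^ (7 / 2 + ε - r) * B) := by ring
    _ ≤ (C * Z + 1) * ((1 + k) ^ (-2 : ℝ) * (1 + α ^ 2 * Real.log k) *
          (N : ℝ) ^ (7 / 2 + ε - r) * B) :=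
        mul_le_mul_of_nonneg_right (by linarith) (by positivity)
    _ = _ := by ring

/-! ### The Chebyshev expansion of `f` and the passage to the limit. -/

theorem sq_mul_le_sobolevTerm {r : ℝ} (φ : ℝ → ℂ) {n : ℤ} (hn : n ≠ 0) :
    (|(n : ℝ)| ^ r * ‖fourierHat φ n‖) ^ 2 = sobolevTerm r φ n := by
  rw [sobolevTerm, if_neg hn, mul_pow, ← Real.rpow_natCast, ← Real.rpow_mul (abs_nonneg _),
    mul_comm r]
  norm_num

theorem sobolevTerm_nonneg (r : ℝ) (φ : ℝ → ℂ) (n : ℤ) : 0 ≤ sobolevTerm r φ n := by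
  unfold sobolevTerm
  split_ifs <;> positivity

/-- For `n ≠ 0` write the coefficient as `(|n| |φ̂(n)|) · (1/|n|)` and use `ab ≤ a² + b²`; both
squares are summable as `r ≥ 1`. -/
theorem summable_fourierHat {r : ℝ} (hr : 1 ≤ r) {φ : ℝ → ℂ} (h : Summable (sobolevTerm r φ)) :
    Summable (fun n : ℤ => ‖fourierHat φ n‖) := by
  refine Summable.of_norm_bounded_eventually
    (h.add (Real.summable_one_div_int_pow (p := 2) |>.2 (by norm_num))) ?_
  filter_upwards [(Set.finite_singleton (0 : ℤ)).compl_mem_cofinite] with n hn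
  have hn0 : n ≠ 0 := hn
  have h1 : (1 : ℝ) ≤ |(n : ℝ)| := by exact_mod_cast Int.one_le_abs hn0
  have h2 : |(n : ℝ)| ≤ |(n : ℝ)| ^ r := by
    simpa using Real.rpow_le_rpow_of_exponent_le h1 hr
  rw [norm_norm, ← sq_mul_le_sobolevTerm φ hn0, ← sq_abs (n : ℝ)]
  set y := ‖fourierHat φ n‖
  have hy : 0 ≤ y := norm_nonneg _
  have h3 : (|(n : ℝ)| * y) ^ 2 ≤ (|(n : ℝ)| ^ r * y) ^ 2 := by gcongr
  refine le_trans ?_ (add_le_add_left h3 _)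
  have h4 : (|(n : ℝ)| * y) * (1 / |(n : ℝ)|) = y := by field_simp
  have h5 : 1 / |(n : ℝ)| ^ 2 = (1 / |(n : ℝ)|) ^ 2 := by rw [one_div_pow]
  rw [h5]
  nlinarith [sq_nonneg (|(n : ℝ)| * y - 1 / |(n : ℝ)|), sq_nonneg (|(n : ℝ)| * y),
    sq_nonneg (1 / |(n : ℝ)|)]

theorem hasSum_fourierHat {φ : ℝ → ℂ} (hφ : Continuous φ) (hp : Function.Periodic φ (2 * π))
    (hs : Summable (fun n : ℤ => ‖fourierHat φ n‖)) (θ : ℝ) :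
    HasSum (fun n : ℤ => fourierHat φ n * Complex.exp (Complex.I * n * θ)) (φ θ) := by
  have : Fact (0 < 2 * π) := ⟨Real.two_pi_pos⟩
  let g : C(AddCircle (2 * π), ℂ) := ⟨hp.lift, continuous_coinduced_dom.2 hφ⟩
  have hc : ∀ n, fourierCoeff g n = fourierHat φ n := fun n => by
    rw [fourierCoeff_eq_intervalIntegral g n (-π), fourierHat_eq,
      show -π + 2 * π = π by ring, Complex.real_smul]
    push_cast
    congr 1
    refine intervalIntegral.integral_congr fun x _ => ?_
    simp only [fourier_coe_apply, smul_eq_mul]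
    rw [mul_comm]
    congr 2
    have hπ : (π : ℂ) ≠ 0 := by exact_mod_cast Real.pi_ne_zero
    push_cast
    field_simp
  have key := has_pointwise_sum_fourier_series_of_summable (f := g)
    (by simpa only [funext hc] using hs.of_norm) (θ : AddCircle (2 * π))
  refine key.congr_fun fun n => ?_
  rw [hc, fourier_coe_apply, smul_eq_mul]
  congr 2
  have hπ : (π : ℂ) ≠ 0 := by exact_mod_cast Real.pi_ne_zero
  push_cast
  field_simp

/-- The Chebyshev coefficients of `f`, from the Fourier coefficients of `θ ↦ f(cos θ)`. -/
noncomputable def chebCoeff (f : ℝ → ℂ) (n : ℕ) : ℂ :=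
  if n = 0 then fourierHat (cosTransform f) 0
  else fourierHat (cosTransform f) n + fourierHat (cosTransform f) (-n)

theorem continuous_cosTransform {f : ℝ → ℂ} (hf : ContinuousOn f (Set.Icc (-1) 1)) :
    Continuous (cosTransform f) :=
  hf.comp_continuous Real.continuous_cos fun θ => Real.cos_mem_Icc θ

theorem summable_norm_chebCoeff {f : ℝ → ℂ}
    (hs : Summable (fun n : ℤ => ‖fourierHat (cosTransform f) n‖)) :
    Summable fun n => ‖chebCoeff f n‖ := by
  have h1 := (hs.comp_injective (i := fun n : ℕ => (n : ℤ)) Nat.cast_injective).add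
    (hs.comp_injective (i := fun n : ℕ => -(n : ℤ)) (fun a b h => by simpa using h))
  refine Summable.of_nonneg_of_le (fun _ => norm_nonneg _) (fun n => ?_) h1
  rw [chebCoeff]
  split_ifs with h
  · subst h; simp
  · exact norm_add_le _ _

theorem hasSum_chebCoeff {f : ℝ → ℂ} (hf : ContinuousOn f (Set.Icc (-1) 1))
    (hp : Function.Periodic (cosTransform f) (2 * π))
    (hs : Summable (fun n : ℤ => ‖fourierHat (cosTransform f) n‖)) {x : ℝ}
    (hx : x ∈ Set.Icc (-1 : ℝ) 1) :
    HasSum (fun n : ℕ => chebCoeff f n * (Chebyshev.T ℂ n).eval (x : ℂ)) (f x) := by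
  set θ := Real.arccos x
  have hc : Real.cos θ = x := Real.cos_arccos hx.1 hx.2
  set φ := cosTransform f with hφ
  have h1 := hasSum_fourierHat (continuous_cosTransform hf) hp hs θ
  have h2 := hasSum_fourierHat (continuous_cosTransform hf) hp hs (-θ)
  have v1 : φ θ = f x := by simp [hφ, cosTransform, hc]
  have v2 : φ (-θ) = f x := by simp [hφ, cosTransform, hc]
  rw [← hφ, v1] at h1
  rw [← hφ, v2] at h2
  -- Averaging the Fourier series at `θ` and `-θ`, where the even function takes the same value,
  -- leaves only cosines.
  have h3 : HasSum (fun n : ℤ => fourierHat φ n * Complex.cos (n * θ)) (f x) := by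
    have := (h1.add h2).div_const 2
    rw [add_self_div_two] at this
    refine this.congr_fun fun n => ?_
    rw [Complex.cos, ← mul_add, mul_div_assoc]
    congr 4
    · ring
    · push_cast; ring
  -- Pairing `n` with `-n` counts the index `0` twice, so one copy is subtracted.
  have h4 := h3.nat_add_neg.sub (hasSum_ite_eq (0 : ℕ) (fourierHat φ 0))
  simp only [Int.cast_zero, zero_mul, Complex.cos_zero, mul_one, add_sub_cancel_right] at h4
  refine h4.congr_fun fun n => ?_
  rw [← hc, eval_T_cos, chebCoeff]
  split_ifs with h
  · subst h; simp [hφ]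
  · push_cast
    rw [neg_mul, Complex.cos_neg]
    ring

theorem sum_sq_chebCoeff_le {f : ℝ → ℂ} {r : ℝ} (hs : Summable (sobolevTerm r (cosTransform f)))
    {S : Finset ℕ} (hS : ∀ n ∈ S, n ≠ 0) :
    √(∑ n ∈ S, ((n : ℝ) ^ r * ‖chebCoeff f n‖) ^ 2) ≤
      2 * periodicSobolevNorm r (cosTransform f) := by
  set φ := cosTransform f with hφ
  have h0 : 0 ∉ S := fun h => hS 0 h rfl
  have h1 : ∑ n ∈ S, (sobolevTerm r φ n + sobolevTerm r φ (-n)) ≤ ∑' n, sobolevTerm r φ n := by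
    have := sum_le_hasSum (insert 0 S)
      (fun n _ => add_nonneg (sobolevTerm_nonneg r φ n) (sobolevTerm_nonneg r φ (-n)))
      hs.hasSum.nat_add_neg
    rw [Finset.sum_insert h0] at this
    simp only [Nat.cast_zero, neg_zero] at this
    linarith [sobolevTerm_nonneg r φ 0]
  have h2 : ∑ n ∈ S, ((n : ℝ) ^ r * ‖chebCoeff f n‖) ^ 2 ≤
      2 ^ 2 * ∑' n, sobolevTerm r φ n := by
    have h3 : ∑ n ∈ S, ((n : ℝ) ^ r * ‖chebCoeff f n‖) ^ 2 ≤
        ∑ n ∈ S, 2 * (sobolevTerm r φ n + sobolevTerm r φ (-n)) := by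
      refine Finset.sum_le_sum fun n hn => ?_
      have hn0 : (n : ℤ) ≠ 0 := by exact_mod_cast hS n hn
      rw [← sq_mul_le_sobolevTerm φ hn0, ← sq_mul_le_sobolevTerm φ (neg_ne_zero.2 hn0),
        chebCoeff, if_neg (hS n hn)]
      simp only [Int.cast_neg, abs_neg, Int.cast_natCast, Nat.abs_cast]
      have hadd := norm_add_le (fourierHat φ n) (fourierHat φ (-n))
      have hnr : 0 ≤ (n : ℝ) ^ r := by positivity
      calc _ ≤ ((n : ℝ) ^ r * (‖fourierHat φ n‖ + ‖fourierHat φ (-n)‖)) ^ 2 := by gcongr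
        _ ≤ _ := by
          nlinarith [sq_nonneg ((n : ℝ) ^ r * ‖fourierHat φ n‖ - (n : ℝ) ^ r * ‖fourierHat φ (-n)‖)]
    rw [← Finset.mul_sum] at h3
    have : 0 ≤ ∑' n, sobolevTerm r φ n := tsum_nonneg (sobolevTerm_nonneg r φ)
    linarith
  refine (Real.sqrt_le_sqrt h2).trans_eq ?_
  rw [Real.sqrt_mul (by norm_num), Real.sqrt_sq (by norm_num), periodicSobolevNorm]

/-- The aliasing errors of the partial sums tend pointwise to `f - Q_N f` and are dominated by `2 ∑
‖c_n‖` times the integrable logarithm, so a bound uniform in the truncation survives the limit. -/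
theorem norm_oscIntegral_sub_filonRule_le {α k B : ℝ} {N : ℕ} (hN : 1 ≤ N) {f : ℝ → ℂ}
    (hf : ContinuousOn f (Set.Icc (-1) 1)) {c : ℕ → ℂ} (hc : Summable fun n => ‖c n‖)
    (hsum : ∀ x ∈ Set.Icc (-1 : ℝ) 1,
      HasSum (fun n : ℕ => c n * (Chebyshev.T ℂ n).eval (x : ℂ)) (f x))
    (hB : ∀ M, ‖oscIntegral α k (fun x => (aliasError N (Finset.Ioc N M) c).eval (x : ℂ))‖ ≤ B) :
    ‖oscIntegral α k f - filonRule α k N f‖ ≤ B := by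
  have hlim : ∀ x ∈ Set.Icc (-1 : ℝ) 1, Filter.Tendsto
      (fun M => (chebSum (Finset.range (M + 1)) c).eval (x : ℂ)) Filter.atTop (nhds (f x)) := by
    intro x hx
    have := (Filter.tendsto_add_atTop_iff_nat 1).2 (hsum x hx).tendsto_sum_nat
    refine this.congr fun M => ?_
    simp [chebSum, Polynomial.eval_finsetSum]
  have hnode : ∀ j, chebNode N j ∈ Set.Icc (-1 : ℝ) 1 := fun j => Real.cos_mem_Icc _
  have herr : ∀ x ∈ Set.Icc (-1 : ℝ) 1, Filter.Tendsto
      (fun M => (aliasError N (Finset.Ioc N M) c).eval (x : ℂ)) Filter.atTop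
      (nhds (f x - (interpolant N f).eval (x : ℂ))) := by
    intro x hx
    have e : ∀ M, (aliasError N (Finset.Ioc N M) c).eval (x : ℂ) =
        (chebSum (Finset.range (M + 1)) c).eval (x : ℂ) -
        (interpolant N
          (fun y => (chebSum (Finset.range (M + 1)) c).eval (y : ℂ))).eval (x : ℂ) := fun M => by
      rw [← sub_interpolant_chebSum hN, Polynomial.eval_sub]
    simp only [e]
    refine (hlim x hx).sub ?_
    -- For fixed `x` the interpolant is a finite linear combination of node values, so convergence
    -- at the nodes is enough.
    simp only [interpolant, Lagrange.interpolate_apply, Polynomial.eval_finsetSum,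
      Polynomial.eval_mul, Polynomial.eval_C]
    exact tendsto_finsetSum _ fun j _ => (hlim _ (hnode j)).mul_const _
  have hbd : ∀ x ∈ Set.Icc (-1 : ℝ) 1, ∀ M,
      ‖(aliasError N (Finset.Ioc N M) c).eval (x : ℂ)‖ ≤ 2 * ∑' n, ‖c n‖ := by
    intro x hx M
    rw [eval_aliasError]
    calc _ ≤ ∑ n ∈ Finset.Ioc N M, 2 * ‖c n‖ := by
          refine (norm_sum_le _ _).trans (Finset.sum_le_sum fun n _ => ?_)
          rw [norm_mul, mul_comm 2]
          refine mul_le_mul_of_nonneg_left ((norm_sub_le _ _).trans ?_) (norm_nonneg _)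
          linarith [norm_eval_T_le hx n, norm_eval_T_le hx (foldIndex N n)]
      _ = 2 * ∑ n ∈ Finset.Ioc N M, ‖c n‖ := by rw [Finset.mul_sum]
      _ ≤ _ := by
          have := hc.sum_le_tsum (Finset.Ioc N M) fun n _ => norm_nonneg _
          linarith
  have hsub : Set.uIoc (-1 : ℝ) 1 ⊆ Set.Icc (-1) 1 := by
    rw [Set.uIoc_of_le (by norm_num)]; exact Set.Ioc_subset_Icc_self
  have hI : Filter.Tendsto
      (fun M => oscIntegral α k (fun x => (aliasError N (Finset.Ioc N M) c).eval (x : ℂ)))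
      Filter.atTop (nhds (oscIntegral α k (fun x => f x - (interpolant N f).eval (x : ℂ)))) := by
    refine intervalIntegral.tendsto_integral_filter_of_dominated_convergence
      (fun x => 2 * (∑' n, ‖c n‖) * |Real.log ((x - α) ^ 2)|)
      (Filter.Eventually.of_forall fun M => ?_) (Filter.Eventually.of_forall fun M => ?_)
      ((intervalIntegrable_log_sq α (-1) 1).abs.const_mul _) ?_
    · exact ((intervalIntegrable_osc (continuous_eval_ofReal _).continuousOn α k).def').1
    · refine Filter.Eventually.of_forall fun x hx => ?_
      rw [norm_mul, norm_mul, norm_cexp_I_mul_mul, mul_one, Complex.norm_real, Real.norm_eq_abs]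
      exact mul_le_mul_of_nonneg_right (hbd x (hsub hx) M) (abs_nonneg _)
    · exact Filter.Eventually.of_forall fun x hx =>
        ((herr x (hsub hx)).mul_const _).mul_const _
  rw [filonRule, ← oscIntegral_sub hf (continuous_eval_ofReal _).continuousOn]
  exact le_of_tendsto hI.norm (Filter.Eventually.of_forall hB)

theorem norm_oscIntegral_sub_filonRule_le_mul {α k A r : ℝ} (hA : 0 ≤ A) (hr : 1 ≤ r) {N : ℕ}
    (hN : 1 ≤ N) {f : ℝ → ℂ} (hf : ContinuousOn f (Set.Icc (-1) 1))
    (hm : MemPeriodicSobolev r (cosTransform f))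
    (h : ∀ (S : Finset ℕ) (c : ℕ → ℂ), (∀ n ∈ S, N < n) →
      ‖oscIntegral α k (fun x => (aliasError N S c).eval (x : ℂ))‖ ≤
        A * √(∑ n ∈ S, ((n : ℝ) ^ r * ‖c n‖) ^ 2)) :
    ‖oscIntegral α k f - filonRule α k N f‖ ≤
      A * (2 * periodicSobolevNorm r (cosTransform f)) := by
  have hs := summable_fourierHat hr hm.2.2
  refine norm_oscIntegral_sub_filonRule_le hN hf (summable_norm_chebCoeff hs)
    (fun x hx => hasSum_chebCoeff hf hm.1 hs hx) fun M => ?_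
  have hS : ∀ n ∈ Finset.Ioc N M, N < n := fun n hn => (Finset.mem_Ioc.1 hn).1
  exact (h _ _ hS).trans (mul_le_mul_of_nonneg_left
    (sum_sq_chebCoeff_le hm.2.2 fun n hn => by have := hS n hn; omega) hA)

end FilonCC

theorem mainTheorem1 :
    (∀ α : ℝ, α ∈ Set.Icc (-1 : ℝ) 1 →
      ∃ C : ℝ, 0 < C ∧
        ∀ (δ r k : ℝ) (N : ℕ) (f : ℝ → ℂ),
          (δ = 0 ∨ δ = 1) → 1 ≤ r → 0 ≤ k → 1 ≤ N →
          ContinuousOn f (Set.Icc (-1 : ℝ) 1) →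
          FilonCC.MemPeriodicSobolev r (FilonCC.cosTransform f) →
          ‖FilonCC.oscIntegral α k f - FilonCC.filonRule α k N f‖ ≤
            C * (1 + k) ^ (-δ) * (N : ℝ) ^ (δ - r) *
              FilonCC.periodicSobolevNorm r (FilonCC.cosTransform f)) ∧
    (∀ ε : ℝ, 0 < ε →
      ∃ C : ℝ, 0 < C ∧
        ∀ (α r k : ℝ) (N : ℕ) (f : ℝ → ℂ),
          (((α = 1 ∨ α = -1) ∧ 1 ≤ k) ∨ (α = 0 ∧ Even N ∧ 0 ≤ k)) →
          7 / 2 + ε < r → 1 ≤ N →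
          ContinuousOn f (Set.Icc (-1 : ℝ) 1) →
          FilonCC.MemPeriodicSobolev r (FilonCC.cosTransform f) →
          ‖FilonCC.oscIntegral α k f - FilonCC.filonRule α k N f‖ ≤
            C * (1 + k) ^ (-2 : ℝ) * (1 + α ^ 2 * Real.log k) *
              (N : ℝ) ^ (7 / 2 + ε - r) *
              FilonCC.periodicSobolevNorm r (FilonCC.cosTransform f)) := by
  refine ⟨fun α hα => ?_, fun ε hε => ?_⟩
  · obtain ⟨C, hC, h⟩ := FilonCC.exists_norm_oscIntegral_aliasError_le hα
    refine ⟨2 * C, by positivity, fun δ r k N f hδ hr hk hN hf hm => ?_⟩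
    refine (FilonCC.norm_oscIntegral_sub_filonRule_le_mul (by positivity) hr hN hf hm
      fun S c hS => h δ r k N S c hδ hr hk hN hS).trans_eq ?_
    ring
  · obtain ⟨C, hC, h⟩ := FilonCC.exists_norm_oscIntegral_aliasError_le_sq hε
    refine ⟨2 * C, by positivity, fun α r k N f hα hr hN hf hm => ?_⟩
    have hk : 0 ≤ k := by rcases hα with h | h <;> linarith [h.2]
    have hw : 0 ≤ 1 + α ^ 2 * Real.log k := by
      rcases hα with ⟨-, h1⟩ | ⟨rfl, -⟩
      · have := Real.log_nonneg h1
        positivity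
      · norm_num
    refine (FilonCC.norm_oscIntegral_sub_filonRule_le_mul (by positivity) (by linarith) hN hf hm
      fun S c hS => h α r k N S c hα hr hN hS).trans_eq ?_
    ring
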